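/- Let $\mathcal{M}(2,\mathbb{C})$ be the space of complex $2\times 2$ matrices. To a polynomial $p(z)=a_kz^k+\dots+a_1z+a_0$ with complex coefficients of degree $k\ge 2$ associate the matrix-valued polynomial $P:\mathcal{M}(2,\mathbb{C})\to\mathcal{M}(2,\mathbb{C})$, $P(M)=a_kM^k+\dots+a_1M+a_0I$. The Fatou set $F_P$ is the set of those $M$ that have an open neighbourhood on which the family of iterates $\{P^n\}_{n\ge1}$ is normal, i.e. every sequence in the family has a subsequence that either converges uniformly on compact subsets or diverges to infinity uniformly on compact subsets of this neighbourhood; the Julia set is $J_P=\mathcal{M}(2,\mathbb{C})\setminus F_P$. Let $P$ and $Q$ be the matrix-valued polynomials associated with complex polynomials $p$ and $q$, both of degree at least $2$. (1) If $P\circ Q=Q\circ P$, then $J_P=J_Q$. (2) Conversely, if $J_P=J_Q$, then there exist $a,b\in\mathbb{C}$ with $|a|=1$ such that $P\circ Q=\Sigma\circ Q\circ P$, where $\Sigma(M)=aM+bI$ for all $M\in\mathcal{M}(2,\mathbb{C})$. -/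

import Mathlib

open Polynomial Filter Topology

/-- A family of maps `F i : E → E` is normal on `U`: every sequence of members of the family has a
subsequence which, uniformly on every compact subset of `U`, either converges to some map `g`
or diverges to infinity, i.e. eventually leaves every compact subset of `E`.
(For holomorphic `F i` on an open set `U` the limit `g` is automatically holomorphic on `U`.) -/
def IsNormalFamilyOn {ι E : Type*} [UniformSpace E] (F : ι → E → E) (U : Set E) : Prop :=
  ∀ s : ℕ → ι, ∃ φ : ℕ → ℕ, StrictMono φ ∧
    ((∃ g : E → E, ∀ K ⊆ U, IsCompact K →
        TendstoUniformlyOn (fun k => F (s (φ k))) g atTop K) ∨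
      (∀ K ⊆ U, IsCompact K → ∀ C : Set E, IsCompact C →
        ∀ᶠ k in atTop, ∀ x ∈ K, F (s (φ k)) x ∉ C))

/-- The Fatou set of `f`: the points having an open neighbourhood on which the iterates `f^n`,
`n ≥ 1`, form a normal family. -/
def fatouSet {E : Type*} [UniformSpace E] (f : E → E) : Set E :=
  {x | ∃ U : Set E, IsOpen U ∧ x ∈ U ∧ IsNormalFamilyOn (fun n : ℕ => f^[n + 1]) U}

/-- The Julia set of `f`: the complement of the Fatou set. -/
def juliaSet {E : Type*} [UniformSpace E] (f : E → E) : Set E :=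
  (fatouSet f)ᶜ

/-- The matrix-valued polynomial `M ↦ a_k M^k + ⋯ + a_1 M + a_0 I` on the space of complex
`2 × 2` matrices corresponding to the polynomial `p = a_k X^k + ⋯ + a_1 X + a_0`. -/
noncomputable def matrixPoly (p : ℂ[X]) (M : Matrix (Fin 2) (Fin 2) ℂ) :
    Matrix (Fin 2) (Fin 2) ℂ :=
  ∑ i ∈ Finset.range (p.natDegree + 1), p.coeff i • M ^ i

/-! Both halves reduce to the filled Julia set K_p ⊂ ℂ of the scalar polynomial p. A polynomial in a
2×2 matrix is given by a value and a divided difference at the two eigenvalues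
(`IsEigenPair.aeval_eq`), so the dynamics can be read off the eigenvalues: M is in J_P iff both
eigenvalues lie in K_p and at least one lies on ∂K_p (`mem_juliaSet_iff`). Scalar matrices recover
∂K_p, and ∂K_p determines K_p by the maximum principle; hence J_P = J_Q iff K_p = K_q.

If p and q commute, then q maps K_p into itself, so K_p ⊆ K_q; by symmetry they are equal.

Conversely, if K_p = K_q, then p and q have the same Green function near infinity
(`HasGreen.le_of_subset`, resting on `bernstein_walsh`). It is multiplied by deg p under p and by
deg q under q, so it agrees at p(q(z)) and q(p(z)). Its expansion log|z - c| + L + O(|z|⁻²) about a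
suitable centre c then makes |p∘q - c|² - |q∘p - c|² bounded near infinity, which forces p∘q - c =
γ(q∘p - c) with |γ| = 1 (`eq_C_mul_of_norm_sq_sub_le`). Evaluating this identity at a matrix gives
Σ. -/

/-- The `n`-th iterate of a polynomial under composition. -/
noncomputable def polyIter (p : ℂ[X]) (n : ℕ) : ℂ[X] := p.comp^[n] X

theorem eval_polyIter (p : ℂ[X]) (n : ℕ) (z : ℂ) :
    (polyIter p n).eval z = (fun x => p.eval x)^[n] z := by
  simp [polyIter, Polynomial.iterate_comp_eval]

theorem eval_polyIter_zero (p : ℂ[X]) (z : ℂ) : (polyIter p 0).eval z = z := by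
  simp [eval_polyIter]

theorem eval_polyIter_succ (p : ℂ[X]) (n : ℕ) (z : ℂ) :
    (polyIter p (n + 1)).eval z = (polyIter p n).eval (p.eval z) := by
  simp [eval_polyIter]

theorem eval_polyIter_succ' (p : ℂ[X]) (n : ℕ) (z : ℂ) :
    (polyIter p (n + 1)).eval z = p.eval ((polyIter p n).eval z) := by
  simp [eval_polyIter, Function.iterate_succ_apply', -Function.iterate_succ]

theorem eval_polyIter_add (p : ℂ[X]) (m n : ℕ) (z : ℂ) :
    (polyIter p (m + n)).eval z = (polyIter p m).eval ((polyIter p n).eval z) := by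
  simp [eval_polyIter, Function.iterate_add_apply]

theorem natDegree_polyIter (p : ℂ[X]) (n : ℕ) : (polyIter p n).natDegree = p.natDegree ^ n := by
  simp [polyIter, Polynomial.natDegree_iterate_comp]

/-! ### Escape radii and filled Julia sets in the plane -/

/-- The filled Julia set of a polynomial: the points with bounded forward orbit. -/
def filledJulia (p : ℂ[X]) : Set ℂ := {z | ∃ B : ℝ, ∀ n, ‖(polyIter p n).eval z‖ ≤ B}

/-- `R` is an escape radius of `p` if `p` at least doubles the modulus of points outside the disc
of radius `R`. -/
def IsEscapeRadius (p : ℂ[X]) (R : ℝ) : Prop :=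
  1 ≤ R ∧ ∀ z : ℂ, R < ‖z‖ → 2 * ‖z‖ ≤ ‖p.eval z‖

theorem IsEscapeRadius.mono {p : ℂ[X]} {R S : ℝ} (h : IsEscapeRadius p R) (hRS : R ≤ S) :
    IsEscapeRadius p S :=
  ⟨h.1.trans hRS, fun z hz => h.2 z (hRS.trans_lt hz)⟩

theorem exists_norm_gt_of_eventually_cobounded {P : ℂ → Prop}
    (h : ∀ᶠ z in Bornology.cobounded ℂ, P z) : ∃ R : ℝ, ∀ z, R < ‖z‖ → P z := by
  obtain ⟨R, -, hR⟩ := Filter.hasBasis_cobounded_norm.eventually_iff.1 h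
  exact ⟨R, fun z hz => hR hz.le⟩

theorem exists_isEscapeRadius {p : ℂ[X]} (hp : 2 ≤ p.natDegree) : ∃ R, IsEscapeRadius p R := by
  have hd : 0 < p.divX.degree := by
    rw [← natDegree_pos_iff_degree_pos, natDegree_divX_eq_natDegree_tsub_one]; omega
  have h := p.divX.tendsto_norm_atTop hd (tendsto_norm_cobounded_atTop (E := ℂ))
  obtain ⟨R, hR⟩ := exists_norm_gt_of_eventually_cobounded (h.eventually_ge_atTop 3)
  refine ⟨max (max 1 R) ‖p.coeff 0‖, by simp, fun z hz => ?_⟩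
  simp only [max_lt_iff] at hz
  have h3 := hR z hz.1.2
  have e : p.eval z = p.divX.eval z * z + p.coeff 0 := by
    conv_lhs => rw [← divX_mul_X_add p]
    simp
  have h4 : ‖p.divX.eval z * z‖ ≤ ‖p.eval z‖ + ‖p.coeff 0‖ := by
    have : p.divX.eval z * z = p.eval z - p.coeff 0 := by rw [e]; ring
    rw [this]; exact norm_sub_le _ _
  rw [norm_mul] at h4
  nlinarith [norm_nonneg z]

theorem IsEscapeRadius.pow_mul_le {p : ℂ[X]} {R : ℝ} (h : IsEscapeRadius p R) {z : ℂ}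
    (hz : R < ‖z‖) (n : ℕ) : 2 ^ n * ‖z‖ ≤ ‖(polyIter p n).eval z‖ := by
  induction n with
  | zero => simp [eval_polyIter_zero]
  | succ n ih =>
    have h1 : R < ‖(polyIter p n).eval z‖ := hz.trans_le <| le_trans
      (le_mul_of_one_le_left (norm_nonneg z) (one_le_pow₀ one_le_two)) ih
    rw [eval_polyIter_succ']
    calc 2 ^ (n + 1) * ‖z‖ = 2 * (2 ^ n * ‖z‖) := by ring
      _ ≤ 2 * ‖(polyIter p n).eval z‖ := by gcongr
      _ ≤ _ := h.2 _ h1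

theorem IsEscapeRadius.le_iter {p : ℂ[X]} {R : ℝ} (h : IsEscapeRadius p R) {z : ℂ}
    (hz : R < ‖z‖) (n : ℕ) : ‖z‖ ≤ ‖(polyIter p n).eval z‖ :=
  le_trans (le_mul_of_one_le_left (norm_nonneg z) (one_le_pow₀ one_le_two)) (h.pow_mul_le hz n)

theorem IsEscapeRadius.lt_iter_of_le {p : ℂ[X]} {R : ℝ} (h : IsEscapeRadius p R) {z : ℂ}
    {m n : ℕ} (hz : R < ‖(polyIter p m).eval z‖) (hmn : m ≤ n) :
    R < ‖(polyIter p n).eval z‖ := by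
  obtain ⟨k, rfl⟩ := Nat.exists_eq_add_of_le' hmn
  rw [eval_polyIter_add]
  exact hz.trans_le (h.le_iter hz k)

theorem mem_filledJulia_iff {p : ℂ[X]} {R : ℝ} (h : IsEscapeRadius p R) {z : ℂ} :
    z ∈ filledJulia p ↔ ∀ n, ‖(polyIter p n).eval z‖ ≤ R := by
  refine ⟨fun ⟨B, hB⟩ n => ?_, fun hz => ⟨R, hz⟩⟩
  by_contra! hn
  obtain ⟨m, hm⟩ := pow_unbounded_of_one_lt B (one_lt_two (α := ℝ))
  have h1 := h.pow_mul_le hn m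
  rw [← eval_polyIter_add] at h1
  have h2 : (1 : ℝ) ≤ ‖(polyIter p n).eval z‖ := h.1.trans hn.le
  nlinarith [hB (m + n), pow_pos (two_pos (α := ℝ)) m]

theorem isClosed_filledJulia {p : ℂ[X]} (hp : 2 ≤ p.natDegree) : IsClosed (filledJulia p) := by
  obtain ⟨R, hR⟩ := exists_isEscapeRadius hp
  have : filledJulia p = ⋂ n, {z | ‖(polyIter p n).eval z‖ ≤ R} := by
    ext z; simp [mem_filledJulia_iff hR]
  rw [this]
  exact isClosed_iInter fun n => isClosed_le (by fun_prop) continuous_const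

theorem filledJulia_subset_closedBall {p : ℂ[X]} {R : ℝ} (hR : IsEscapeRadius p R) :
    filledJulia p ⊆ Metric.closedBall 0 R := fun z hz => by
  simpa [eval_polyIter_zero] using (mem_filledJulia_iff hR).1 hz 0

theorem isBounded_filledJulia {p : ℂ[X]} (hp : 2 ≤ p.natDegree) :
    Bornology.IsBounded (filledJulia p) := by
  obtain ⟨R, hR⟩ := exists_isEscapeRadius hp
  exact Metric.isBounded_closedBall.subset (filledJulia_subset_closedBall hR)

theorem eval_mem_filledJulia_iff {p : ℂ[X]} {z : ℂ} :
    p.eval z ∈ filledJulia p ↔ z ∈ filledJulia p := by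
  constructor
  · rintro ⟨B, hB⟩
    refine ⟨max B ‖z‖, fun n => ?_⟩
    cases n with
    | zero => simp [eval_polyIter_zero]
    | succ n => rw [eval_polyIter_succ]; exact (hB n).trans (le_max_left _ _)
  · rintro ⟨B, hB⟩
    exact ⟨B, fun n => by rw [← eval_polyIter_succ]; exact hB (n + 1)⟩

theorem iter_mem_filledJulia_iff {p : ℂ[X]} {z : ℂ} (n : ℕ) :
    (polyIter p n).eval z ∈ filledJulia p ↔ z ∈ filledJulia p := by
  induction n with
  | zero => rw [eval_polyIter_zero]
  | succ n ih => rw [eval_polyIter_succ', eval_mem_filledJulia_iff, ih]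

/-- Compact sets of escaping points leave the escape disc simultaneously. -/
theorem exists_iter_gt_of_isCompact {p : ℂ[X]} {R : ℝ} (hR : IsEscapeRadius p R) {L : Set ℂ}
    (hL : IsCompact L) (hd : Disjoint L (filledJulia p)) :
    ∃ m, ∀ n ≥ m, ∀ z ∈ L, R < ‖(polyIter p n).eval z‖ := by
  obtain ⟨m, hm⟩ := hL.elim_directed_cover (fun n => {z | R < ‖(polyIter p n).eval z‖})
    (fun n => isOpen_lt continuous_const (by fun_prop)) (fun z hz => by
      have := Set.disjoint_left.1 hd hz
      rw [mem_filledJulia_iff hR] at this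
      simpa using this)
    (directed_of_isDirected_le fun i j hij z hz => hR.lt_iter_of_le hz hij)
  exact ⟨m, fun n hn z hz => hR.lt_iter_of_le (hm hz) hn⟩

theorem eventually_iter_gt_of_isCompact {p : ℂ[X]} (hp : 2 ≤ p.natDegree) {L : Set ℂ}
    (hL : IsCompact L) (hd : Disjoint L (filledJulia p)) (C : ℝ) :
    ∀ᶠ n in atTop, ∀ z ∈ L, C < ‖(polyIter p n).eval z‖ := by
  obtain ⟨R, hR⟩ := exists_isEscapeRadius hp
  obtain ⟨m, hm⟩ := exists_iter_gt_of_isCompact (hR.mono (le_max_left R C)) hL hd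
  filter_upwards [eventually_ge_atTop m] with n hn z hz
  exact (le_max_right R C).trans_lt (hm n hn z hz)

/-! ### Comparing two filled Julia sets -/

/-- Since pⁿ∘q = q∘pⁿ and q is bounded on a disc, q preserves K_p; thus q-orbits starting in K_p
never leave this bounded set. -/
theorem filledJulia_subset_of_commute {p q : ℂ[X]} (hp : 2 ≤ p.natDegree)
    (h : ∀ z, p.eval (q.eval z) = q.eval (p.eval z)) : filledJulia p ⊆ filledJulia q := by
  have hq : ∀ z ∈ filledJulia p, q.eval z ∈ filledJulia p := by
    intro z hz
    obtain ⟨R, hR⟩ := exists_isEscapeRadius hp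
    obtain ⟨B, hB⟩ := (isCompact_closedBall (0 : ℂ) R).exists_bound_of_continuousOn
      (f := fun z => q.eval z) (by fun_prop)
    refine ⟨B, fun n => ?_⟩
    have hc : (polyIter p n).eval (q.eval z) = q.eval ((polyIter p n).eval z) := by
      induction n with
      | zero => simp only [eval_polyIter_zero]
      | succ n ih => rw [eval_polyIter_succ', ih, h, eval_polyIter_succ']
    rw [hc]
    exact hB _ (by simpa using (mem_filledJulia_iff hR).1 hz n)
  intro z hz
  have hn : ∀ n, (polyIter q n).eval z ∈ filledJulia p := fun n => by
    induction n with
    | zero => rwa [eval_polyIter_zero]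
    | succ n ih => rw [eval_polyIter_succ']; exact hq _ ih
  obtain ⟨B, hB⟩ := (isBounded_filledJulia hp).exists_norm_le
  exact ⟨B, fun n => hB _ (hn n)⟩

/-- Maximum principle: every iterate of q is bounded by one escape radius on the common frontier,
hence on all of K_p. -/
theorem filledJulia_subset_of_frontier_eq {p q : ℂ[X]} (hp : 2 ≤ p.natDegree)
    (hq : 2 ≤ q.natDegree) (h : frontier (filledJulia p) = frontier (filledJulia q)) :
    filledJulia p ⊆ filledJulia q := by
  obtain ⟨R, hR⟩ := exists_isEscapeRadius hq
  intro z hz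
  refine ⟨R, fun n => ?_⟩
  refine Complex.norm_le_of_forall_mem_frontier_norm_le (isBounded_filledJulia hp)
    (Differentiable.diffContOnCl (polyIter q n).differentiable) (fun w hw => ?_) (subset_closure hz)
  rw [h] at hw
  exact (mem_filledJulia_iff hR).1 ((isClosed_filledJulia hq).frontier_subset hw) n

/-! ### Filled Julia sets have no isolated points -/

/-- If K_p = {c}, complete invariance makes c its own only preimage, so p - c vanishes at c to order
at least 2. Then c is a superattracting fixed point, and a whole disc around it has bounded orbits.
-/
theorem filledJulia_ne_singleton {p : ℂ[X]} (hp : 2 ≤ p.natDegree) (c : ℂ) :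
    filledJulia p ≠ {c} := by
  intro hK
  have hfix : ∀ z, p.eval z = c ↔ z = c := fun z => by
    have := eval_mem_filledJulia_iff (p := p) (z := z)
    simpa [hK] using this
  have h1 : (X - C c) ∣ p - C c := by
    rw [dvd_iff_isRoot]; simp [(hfix c).2 rfl]
  obtain ⟨g, hg⟩ := h1
  have hdeg : g.natDegree ≠ 0 := by
    intro h0
    have := natDegree_mul_le (p := X - C c) (q := g)
    rw [← hg, natDegree_sub_C, natDegree_X_sub_C, h0] at this
    omega
  obtain ⟨w, hw⟩ := IsAlgClosed.exists_root g (fun h => hdeg (natDegree_eq_of_degree_eq_some h))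
  have hwc : w = c := by
    rw [← hfix]
    have := congrArg (eval w) hg
    rw [eval_mul, hw.eq_zero] at this
    simpa [sub_eq_zero] using this
  subst hwc
  obtain ⟨r, hr⟩ := dvd_iff_isRoot.2 hw
  have he : ∀ z, p.eval z - w = (z - w) ^ 2 * r.eval z := fun z => by
    have := congrArg (eval z) hg
    rw [hr] at this
    simp at this
    rw [this]; ring
  have hc : ContinuousAt (fun z => ‖(z - w) * r.eval z‖) w := by fun_prop
  have hev : ∀ᶠ z in 𝓝 w, ‖(z - w) * r.eval z‖ < 1 :=
    hc.eventually_lt continuousAt_const (by simp)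
  obtain ⟨ε, hε, hb⟩ := Metric.eventually_nhds_iff_ball.1 hev
  have hsub : Metric.ball w ε ⊆ filledJulia p := by
    intro z hz
    refine ⟨‖w‖ + ε, fun n => ?_⟩
    have : (polyIter p n).eval z ∈ Metric.ball w ε := by
      induction n with
      | zero => rwa [eval_polyIter_zero]
      | succ n ih =>
        rw [eval_polyIter_succ', Metric.mem_ball, dist_eq_norm, he, pow_two, mul_assoc, norm_mul]
        rw [Metric.mem_ball, dist_eq_norm] at ih
        have := hb _ ((dist_eq_norm _ _).trans_lt ih)
        refine lt_of_le_of_lt (mul_le_of_le_one_right (norm_nonneg _) this.le) ih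
    rw [Metric.mem_ball, dist_eq_norm] at this
    have h2 := norm_add_le w ((polyIter p n).eval z - w)
    rw [add_sub_cancel] at h2
    linarith
  rw [hK] at hsub
  have := @hsub (w + (ε / 2 : ℝ)) (by simp [abs_of_pos hε]; linarith)
  simp at this
  exact hε.ne' this

/-- The filled Julia set has no isolated points. -/
theorem exists_mem_filledJulia_near {p : ℂ[X]} (hp : 2 ≤ p.natDegree) {c : ℂ}
    (hc : c ∈ filledJulia p) {ε : ℝ} (hε : 0 < ε) :
    ∃ w ∈ filledJulia p, w ≠ c ∧ dist w c < ε := by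
  by_contra! hcon
  have hiso : ∀ w ∈ Metric.closedBall c (ε / 2), w ∈ filledJulia p → w = c := by
    intro w hw hwK
    by_contra hne
    have := hcon w hwK hne
    rw [Metric.mem_closedBall] at hw
    linarith
  obtain ⟨R, hR⟩ := exists_isEscapeRadius hp
  have hR1 := hR.1
  have hdisj : Disjoint (Metric.sphere c (ε / 2)) (filledJulia p) := by
    rw [Set.disjoint_left]
    intro w hw hwK
    have := hiso w (Metric.sphere_subset_closedBall hw) hwK
    subst this
    simp at hw
    linarith
  obtain ⟨n, hn⟩ := (eventually_iter_gt_of_isCompact hp (isCompact_sphere c (ε / 2)) hdisj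
    (6 * R)).exists
  set f := polyIter p n
  have hfc : ‖f.eval c‖ ≤ R := (mem_filledJulia_iff hR).1 hc n
  have hfreq : ∃ᶠ z in 𝓝 c, f.eval z ≠ f.eval c := by
    have : ∀ᶠ z in 𝓝[≠] c, f.eval z ≠ f.eval c := by
      have hb : ∀ᶠ z in 𝓝[≠] c, z ∈ Metric.closedBall c (ε / 2) :=
        nhdsWithin_le_nhds (Metric.closedBall_mem_nhds c (half_pos hε))
      filter_upwards [hb, self_mem_nhdsWithin] with z hz hzc heq
      refine hzc (hiso z hz ?_)
      rw [← iter_mem_filledJulia_iff n]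
      change f.eval z ∈ _
      rw [heq]
      exact (iter_mem_filledJulia_iff n).2 hc
    exact this.frequently.filter_mono nhdsWithin_le_nhds
  -- Quantitative open mapping: the circle around the isolated point c is sent far away, so the
  -- image of the disc covers K_p. The only point of K_p in that disc is c, so K_p would be a
  -- singleton.
  have hball := (Differentiable.diffContOnCl f.differentiable).ball_subset_image_closedBall
    (half_pos hε) (ε := 5 * R) (fun z hz => by
      have := hn z hz
      have h2 := norm_sub_norm_le (f.eval z) (f.eval c)
      linarith) hfreq
  have hK : ∀ w ∈ filledJulia p, w = f.eval c := by
    intro w hw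
    have hwR : ‖w‖ ≤ R := by simpa using filledJulia_subset_closedBall hR hw
    obtain ⟨z, hz, rfl⟩ := hball (show w ∈ Metric.ball (f.eval c) (5 * R / 2) by
      rw [Metric.mem_ball, dist_eq_norm]
      have := norm_sub_le w (f.eval c)
      linarith)
    rw [hiso z hz ((iter_mem_filledJulia_iff n).1 hw)]
  refine filledJulia_ne_singleton hp (f.eval c) ?_
  exact Set.eq_singleton_iff_unique_mem.2 ⟨(iter_mem_filledJulia_iff n).2 hc, hK⟩

section MatrixDynamics

attribute [local instance] Matrix.normedAddCommGroup Matrix.normedSpace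

/-! ### Extracting convergent subsequences -/

/-- An index sequence either takes some value infinitely often, giving a constant subsequence, or
has a strictly increasing subsequence. -/
theorem isNormalFamilyOn_of_strictMono {E : Type*} [UniformSpace E] {F : ℕ → E → E} {U : Set E}
    (h : ∀ s : ℕ → ℕ, StrictMono s → ∃ φ : ℕ → ℕ, StrictMono φ ∧
      ((∃ g : E → E, ∀ K ⊆ U, IsCompact K →
          TendstoUniformlyOn (fun k => F (s (φ k))) g atTop K) ∨
        (∀ K ⊆ U, IsCompact K → ∀ C : Set E, IsCompact C →
          ∀ᶠ k in atTop, ∀ x ∈ K, F (s (φ k)) x ∉ C))) :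
    IsNormalFamilyOn F U := by
  intro s
  by_cases hs : ∃ n, ∃ᶠ k in atTop, s k = n
  · obtain ⟨n, hn⟩ := hs
    obtain ⟨φ, hφ, hφn⟩ := Filter.extraction_of_frequently_atTop hn
    refine ⟨φ, hφ, Or.inl ⟨F n, fun K _ _ => ?_⟩⟩
    simp only [hφn]
    intro u hu
    exact Eventually.of_forall fun _ x _ => refl_mem_uniformity hu
  · simp only [not_exists, not_frequently] at hs
    have ht : Tendsto s atTop atTop := by
      rw [tendsto_atTop]
      intro b
      have : ∀ᶠ k in atTop, ∀ n ∈ Finset.range b, s k ≠ n :=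
        (Finset.eventually_all _).2 fun n _ => hs n
      filter_upwards [this] with k hk
      by_contra! hlt
      exact hk _ (Finset.mem_range.2 hlt) rfl
    obtain ⟨ψ, hψ, hsψ⟩ := strictMono_subseq_of_tendsto_atTop ht
    obtain ⟨φ, hφ, H⟩ := h _ hsψ
    exact ⟨ψ ∘ φ, hψ.comp hφ, H⟩

theorem exists_subseq_tendstoUniformlyOn {E G : Type*} [MetricSpace E] [NormedAddCommGroup G]
    [ProperSpace G] {B : Set E} (hB : IsCompact B) (F : ℕ → E → G) (L C : ℝ)
    (hL : ∀ n, ∀ x ∈ B, ∀ y ∈ B, dist (F n x) (F n y) ≤ L * dist x y)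
    (hC : ∀ n, ∀ x ∈ B, ‖F n x‖ ≤ C) :
    ∃ φ : ℕ → ℕ, StrictMono φ ∧ ∃ g : E → G, TendstoUniformlyOn (fun k => F (φ k)) g atTop B := by
  classical
  have : CompactSpace B := isCompact_iff_compactSpace.1 hB
  have hcont : ∀ n, Continuous (fun x : B => F n x) := fun n =>
    (LipschitzWith.of_dist_le_mul (K := L.toNNReal) (f := fun x : B => F n x) fun x y =>
      (hL n x x.2 y y.2).trans (by
        rw [Subtype.dist_eq]; gcongr; exact Real.le_coe_toNNReal L)).continuous
  let f : ℕ → BoundedContinuousFunction B G := fun n =>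
    BoundedContinuousFunction.mkOfCompact ⟨fun x => F n x, hcont n⟩
  have hcpt : IsCompact (closure (Set.range f)) := by
    refine BoundedContinuousFunction.arzela_ascoli (Metric.closedBall (0 : G) C)
      (isCompact_closedBall _ _) _ ?_ ?_
    · rintro _ x ⟨n, rfl⟩
      simpa [f] using hC n x x.2
    · refine Metric.equicontinuous_of_continuity_modulus (fun t => L * t) ?_ _ ?_
      · have : Continuous fun t : ℝ => L * t := by fun_prop
        simpa using this.tendsto 0
      · rintro x y ⟨_, n, rfl⟩
        exact hL n x x.2 y y.2
  obtain ⟨g, -, φ, hφ, hg⟩ := hcpt.tendsto_subseq (x := f) fun n => subset_closure ⟨n, rfl⟩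
  -- The value 0 off `B` is arbitrary: convergence is only claimed on `B`.
  refine ⟨φ, hφ, fun x => if h : x ∈ B then g ⟨x, h⟩ else 0, ?_⟩
  rw [BoundedContinuousFunction.tendsto_iff_tendstoUniformly] at hg
  rw [tendstoUniformlyOn_iff_tendstoUniformly_comp_coe]
  convert hg using 1
  · rfl
  · ext x
    simp

/-! ### Eigenvalues and functional calculus of 2×2 matrices -/

theorem matrixPoly_eq_aeval (p : ℂ[X]) (M : Matrix (Fin 2) (Fin 2) ℂ) :
    matrixPoly p M = aeval M p := by
  rw [aeval_eq_sum_range, matrixPoly]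

theorem matrixPoly_iterate (p : ℂ[X]) (n : ℕ) (M : Matrix (Fin 2) (Fin 2) ℂ) :
    (matrixPoly p)^[n] M = aeval M (polyIter p n) := by
  induction n with
  | zero => simp [polyIter]
  | succ n ih =>
    rw [Function.iterate_succ_apply', ih, matrixPoly_eq_aeval, ← aeval_comp, polyIter, polyIter,
      Function.iterate_succ_apply']

/-- `a` and `b` are the two eigenvalues of the `2 × 2` matrix `M`, with multiplicity. -/
def IsEigenPair (M : Matrix (Fin 2) (Fin 2) ℂ) (a b : ℂ) : Prop :=
  M.trace = a + b ∧ M.det = a * b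

namespace IsEigenPair

variable {M : Matrix (Fin 2) (Fin 2) ℂ} {a b : ℂ}

theorem symm (h : IsEigenPair M a b) : IsEigenPair M b a :=
  ⟨h.1.trans (add_comm _ _), h.2.trans (mul_comm _ _)⟩

theorem exists_isEigenPair (M : Matrix (Fin 2) (Fin 2) ℂ) : ∃ a b, IsEigenPair M a b := by
  obtain ⟨s, hs⟩ := IsAlgClosed.exists_pow_nat_eq (M.trace ^ 2 - 4 * M.det) two_pos
  exact ⟨(M.trace + s) / 2, (M.trace - s) / 2, by ring, by linear_combination (1 / 4) * hs⟩

theorem smul_one (c : ℂ) : IsEigenPair (c • 1) c c := by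
  constructor
  · simp; ring
  · simp; ring

theorem add_smul_one (h : IsEigenPair M a b) (t : ℂ) :
    IsEigenPair (M + t • 1) (a + t) (b + t) := by
  obtain ⟨h1, h2⟩ := h
  rw [Matrix.trace_fin_two] at h1
  rw [Matrix.det_fin_two] at h2
  constructor
  · simp [Matrix.trace_fin_two]; linear_combination h1
  · simp [Matrix.det_fin_two]; linear_combination h2 + t * h1

theorem sub_mul_sub (h : IsEigenPair M a b) : (M - a • 1) * (M - b • 1) = 0 := by
  obtain ⟨h1, h2⟩ := h
  rw [Matrix.trace_fin_two] at h1
  rw [Matrix.det_fin_two] at h2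
  ext i j
  fin_cases i <;> fin_cases j <;> simp [Matrix.mul_apply, Fin.sum_univ_two]
  · linear_combination M 0 0 * h1 - h2
  · linear_combination M 0 1 * h1
  · linear_combination M 1 0 * h1
  · linear_combination M 1 1 * h1 - h2

/-- A polynomial in `M`, expressed by values and the divided difference at the eigenvalues. -/
theorem aeval_eq (h : IsEigenPair M a b) (f : ℂ[X]) :
    aeval M f = f.eval a • (1 : Matrix (Fin 2) (Fin 2) ℂ)
      + (f /ₘ (X - C a)).eval b • (M - a • 1) := by
  -- Newton interpolation: divide by X - a, then divide the quotient by X - b; Cayley–Hamilton kills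
  -- the remainder. No distinction between simple and double eigenvalues is needed.
  have key : ∀ (f : ℂ[X]) (c : ℂ),
      aeval M f = f.eval c • 1 + (M - c • 1) * aeval M (f /ₘ (X - C c)) := by
    intro f c
    conv_lhs => rw [← modByMonic_add_div f (X - C c), modByMonic_X_sub_C_eq_C_eval]
    simp [Algebra.algebraMap_eq_smul_one]
  rw [key f a, key (f /ₘ (X - C a)) b, mul_add, ← mul_assoc, h.sub_mul_sub]
  simp

end IsEigenPair

theorem sub_mul_eval_divByMonic (f : ℂ[X]) (a b : ℂ) :
    (b - a) * (f /ₘ (X - C a)).eval b = f.eval b - f.eval a := by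
  conv_rhs => rw [← modByMonic_add_div f (X - C a), modByMonic_X_sub_C_eq_C_eval]
  simp

theorem norm_eval_divByMonic_le {f : ℂ[X]} {a b : ℂ} {B δ : ℝ} (hδ : 0 < δ)
    (hab : δ ≤ ‖b - a‖) (ha : ‖f.eval a‖ ≤ B) (hb : ‖f.eval b‖ ≤ B) :
    ‖(f /ₘ (X - C a)).eval b‖ ≤ 2 * B / δ := by
  rw [le_div_iff₀ hδ]
  calc _ ≤ ‖(f /ₘ (X - C a)).eval b‖ * ‖b - a‖ := by gcongr
    _ = ‖f.eval b - f.eval a‖ := by rw [← sub_mul_eval_divByMonic, norm_mul, mul_comm]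
    _ ≤ _ := (norm_sub_le _ _).trans (by linarith)

/-- The divided difference is a polynomial in b, so for b close to a the maximum principle moves the
estimate to the circle |z - a| = δ, where the denominator is harmless. -/
theorem norm_eval_divByMonic_le_of_ball {f : ℂ[X]} {a b : ℂ} {B δ : ℝ} (hδ : 0 < δ)
    (ha : ∀ z ∈ Metric.closedBall a δ, ‖f.eval z‖ ≤ B) (hb : ‖f.eval b‖ ≤ B) :
    ‖(f /ₘ (X - C a)).eval b‖ ≤ 2 * B / δ := by
  have haa := ha a (Metric.mem_closedBall_self hδ.le)
  rcases le_or_gt δ ‖b - a‖ with h | h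
  · exact norm_eval_divByMonic_le hδ h haa hb
  · refine Complex.norm_le_of_forall_mem_frontier_norm_le (U := Metric.ball a δ)
      (f := fun z => (f /ₘ (X - C a)).eval z)
      Metric.isBounded_ball (Differentiable.diffContOnCl (Polynomial.differentiable _))
      (fun z hz => ?_) (subset_closure (by rwa [Metric.mem_ball, dist_eq_norm]))
    rw [frontier_ball _ hδ.ne'] at hz
    refine norm_eval_divByMonic_le hδ ?_ haa (ha z (Metric.sphere_subset_closedBall hz))
    rw [← dist_eq_norm]
    exact (Metric.mem_sphere.1 hz).ge

namespace IsEigenPair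

variable {M : Matrix (Fin 2) (Fin 2) ℂ} {a b : ℂ}

theorem aeval (h : IsEigenPair M a b) (f : ℂ[X]) :
    IsEigenPair (aeval M f) (f.eval a) (f.eval b) := by
  rw [h.aeval_eq f]
  have hc := sub_mul_eval_divByMonic f a b
  obtain ⟨h1, h2⟩ := h
  rw [Matrix.trace_fin_two] at h1
  rw [Matrix.det_fin_two] at h2
  set c := (f /ₘ (X - C a)).eval b
  constructor
  · simp [Matrix.trace_fin_two]; linear_combination c * h1 + hc
  · simp [Matrix.det_fin_two]
    linear_combination c ^ 2 * h2 - c ^ 2 * a * h1 + f.eval a * (c * h1 + hc)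

theorem norm_le (h : IsEigenPair M a b) : ‖a‖ ≤ ‖M.trace‖ + ‖M.det‖ + 1 := by
  rcases le_or_gt ‖a‖ 1 with h1 | h1
  · linarith [norm_nonneg M.trace, norm_nonneg M.det]
  · have e : a ^ 2 = M.trace * a - M.det := by rw [h.1, h.2]; ring
    have e2 := congrArg norm e
    rw [norm_pow] at e2
    have e3 := norm_sub_le (M.trace * a) M.det
    rw [norm_mul] at e3
    nlinarith [norm_nonneg M.trace, norm_nonneg M.det]

theorem norm_le_of_norm_le (h : IsEigenPair M a b) {B : ℝ} (hM : ‖M‖ ≤ B) :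
    ‖a‖ ≤ 2 * B + 2 * B ^ 2 + 1 := by
  have he : ∀ i j, ‖M i j‖ ≤ B := fun i j => (Matrix.norm_entry_le_entrywise_sup_norm M).trans hM
  have hB : 0 ≤ B := (norm_nonneg M).trans hM
  have ht : ‖M.trace‖ ≤ 2 * B := by
    rw [Matrix.trace_fin_two]
    linarith [norm_add_le (M 0 0) (M 1 1), he 0 0, he 1 1]
  have hd : ‖M.det‖ ≤ 2 * B ^ 2 := by
    rw [Matrix.det_fin_two]
    refine (norm_sub_le _ _).trans ?_
    rw [norm_mul, norm_mul]
    have := mul_le_mul (he 0 0) (he 1 1) (norm_nonneg _) hB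
    have := mul_le_mul (he 0 1) (he 1 0) (norm_nonneg _) hB
    linarith
  linarith [h.norm_le]

/-- Eigenvalues depend continuously on the matrix. -/
theorem eventually_near (h : IsEigenPair M a b) {δ : ℝ} (hδ : 0 < δ) :
    ∀ᶠ N in 𝓝 M, ∀ c d, IsEigenPair N c d →
      (dist c a < δ ∨ dist c b < δ) ∧ (dist c a < δ ∨ dist d a < δ) := by
  have hc : Continuous fun N : Matrix (Fin 2) (Fin 2) ℂ =>
      ‖N.trace - M.trace‖ * (‖N.trace‖ + ‖N.det‖ + 1 + ‖a‖) + ‖N.det - M.det‖ := by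
    fun_prop
  filter_upwards [hc.continuousAt.eventually_lt (x₀ := M)
    (continuousAt_const (y := δ ^ 2)) (by simp; positivity)] with N hN c d hcd
  have aux : ∀ x y w v : ℂ, ‖(x - y) * (w - v)‖ < δ ^ 2 → ‖x - y‖ < δ ∨ ‖w - v‖ < δ := by
    intro x y w v hxy
    by_contra! hcon
    rw [norm_mul] at hxy
    nlinarith [mul_le_mul hcon.1 hcon.2 hδ.le (norm_nonneg _)]
  have hcn := hcd.norm_le
  refine ⟨?_, ?_⟩
  · rw [dist_eq_norm, dist_eq_norm]
    apply aux
    -- This is the characteristic polynomial of M at an eigenvalue of N, hence small; one of the two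
    -- factors must then be small.
    have e : (c - a) * (c - b) = (N.trace - M.trace) * c - (N.det - M.det) := by
      rw [h.1, h.2, hcd.1, hcd.2]; ring
    rw [e]
    refine lt_of_le_of_lt (norm_sub_le _ _) (lt_of_le_of_lt ?_ hN)
    rw [norm_mul]
    gcongr
    linarith [norm_nonneg a]
  · rw [dist_eq_norm, dist_eq_norm]
    apply aux
    -- The same argument with the roles of M and N exchanged.
    have e : (c - a) * (d - a) = (N.det - M.det) - (N.trace - M.trace) * a := by
      rw [h.1, h.2, hcd.1, hcd.2]; ring
    rw [e]
    refine lt_of_le_of_lt (norm_sub_le _ _) (lt_of_le_of_lt ?_ hN)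
    rw [norm_mul, add_comm]
    gcongr
    linarith [norm_nonneg c]

theorem norm_aeval_le (h : IsEigenPair M a b) (f : ℂ[X]) :
    ‖Polynomial.aeval M f‖ ≤ ‖f.eval a‖ * ‖(1 : Matrix (Fin 2) (Fin 2) ℂ)‖ +
      ‖(f /ₘ (X - C a)).eval b‖ * (‖M‖ + ‖a‖ * ‖(1 : Matrix (Fin 2) (Fin 2) ℂ)‖) := by
  rw [h.aeval_eq f]
  refine (norm_add_le _ _).trans ?_
  rw [norm_smul, norm_smul]
  gcongr
  refine (norm_sub_le _ _).trans ?_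
  rw [norm_smul]

theorem iterate {p : ℂ[X]} (h : IsEigenPair M a b) (n : ℕ) :
    IsEigenPair ((matrixPoly p)^[n] M) ((polyIter p n).eval a) ((polyIter p n).eval b) := by
  rw [matrixPoly_iterate]
  exact h.aeval _

end IsEigenPair

/-! ### The Fatou–Julia dichotomy in terms of eigenvalues -/

/-- Nearby matrices have an eigenvalue near a, these eigenvalues escape uniformly, and the matrix
norm controls the eigenvalues: locally uniform divergence. -/
theorem mem_fatouSet_of_notMem {p : ℂ[X]} (hp : 2 ≤ p.natDegree)
    {M : Matrix (Fin 2) (Fin 2) ℂ} {a b : ℂ} (h : IsEigenPair M a b) (ha : a ∉ filledJulia p) :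
    M ∈ fatouSet (matrixPoly p) := by
  obtain ⟨δ, hδ, hsub⟩ := Metric.nhds_basis_closedBall.mem_iff.1
    ((isClosed_filledJulia hp).isOpen_compl.mem_nhds ha)
  obtain ⟨U, hUn, hU, hMU⟩ := eventually_nhds_iff.1 (h.eventually_near hδ)
  refine ⟨U, hU, hMU, isNormalFamilyOn_of_strictMono fun s hs => ⟨id, strictMono_id, Or.inr ?_⟩⟩
  intro K hKU _ C hC
  obtain ⟨B, hB⟩ := hC.isBounded.exists_norm_le
  have hev := eventually_iter_gt_of_isCompact hp (isCompact_closedBall a δ)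
    (Set.disjoint_left.2 fun z hz => hsub hz) (2 * B + 2 * B ^ 2 + 1)
  have ht : Tendsto (fun k => s k + 1) atTop atTop :=
    (tendsto_add_atTop_nat 1).comp hs.tendsto_atTop
  filter_upwards [ht.eventually hev] with k hk N hN hNC
  obtain ⟨c, d, hcd⟩ := IsEigenPair.exists_isEigenPair N
  have hbound := hB _ hNC
  rcases ((hUn N (hKU hN)) c d hcd).2 with hc | hd
  · exact absurd (hk c (Metric.mem_closedBall.2 hc.le))
      (not_lt.2 ((hcd.iterate (s k + 1)).norm_le_of_norm_le hbound))
  · exact absurd (hk d (Metric.mem_closedBall.2 hd.le))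
      (not_lt.2 ((hcd.symm.iterate (s k + 1)).norm_le_of_norm_le hbound))

theorem differentiable_aeval_line (f : ℂ[X]) (A D : Matrix (Fin 2) (Fin 2) ℂ) :
    Differentiable ℂ fun t : ℂ => aeval (A + t • D) f := by
  have hpow : ∀ n i j, Differentiable ℂ fun t : ℂ => ((A + t • D) ^ n) i j := by
    intro n
    induction n with
    | zero => intro i j; simp
    | succ n ih =>
      intro i j
      have hlin : ∀ i j, Differentiable ℂ fun t : ℂ => A i j + t * D i j := fun i j => by fun_prop
      simp only [pow_succ, Matrix.mul_apply, Fin.sum_univ_two]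
      exact ((ih i 0).mul (hlin 0 j)).add ((ih i 1).mul (hlin 1 j))
  refine differentiable_pi.2 fun i => differentiable_pi.2 fun j => ?_
  simp only [aeval_eq_sum_range, Matrix.sum_apply, Matrix.smul_apply]
  exact Differentiable.fun_sum fun n _ => (hpow n i j).const_mul (f.coeff n)

/-- A polynomial map that is bounded on a ball is Lipschitz on the concentric half ball. -/
theorem dist_aeval_le {f : ℂ[X]} {M : Matrix (Fin 2) (Fin 2) ℂ} {r B : ℝ} (hr : 0 < r)
    (hB : ∀ N ∈ Metric.ball M (2 * r), ‖aeval N f‖ ≤ B) {x y : Matrix (Fin 2) (Fin 2) ℂ}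
    (hx : x ∈ Metric.closedBall M r) (hy : y ∈ Metric.closedBall M r) :
    dist (aeval x f) (aeval y f) ≤ (2 * B + 1) / r * dist x y := by
  have hsub : Metric.closedBall M r ⊆ Metric.ball M (2 * r) :=
    Metric.closedBall_subset_ball (by linarith)
  have hB0 : 0 ≤ B := (norm_nonneg _).trans (hB x (hsub hx))
  have hdist : ∀ u ∈ Metric.ball M (2 * r), ∀ v ∈ Metric.ball M (2 * r),
      dist (aeval u f) (aeval v f) < 2 * B + 1 := by
    intro u hu v hv
    rw [dist_eq_norm]
    linarith [norm_sub_le (aeval u f) (aeval v f), hB u hu, hB v hv]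
  rcases le_or_gt r (dist x y) with hd | hd
  · calc _ ≤ 2 * B + 1 := (hdist x (hsub hx) y (hsub hy)).le
      _ = (2 * B + 1) / r * r := by field_simp
      _ ≤ _ := by gcongr
  rcases eq_or_ne x y with rfl | hxy
  · simp
  have hpos : 0 < dist x y := dist_pos.2 hxy
  -- Schwarz lemma on the complex line through y and x, compared at the parameters t = 0 and t = 1.
  have h1 := Complex.dist_le_div_mul_dist_of_mapsTo_ball (c := (0 : ℂ)) (z := 1)
    (R₁ := r / dist x y) (R₂ := 2 * B + 1) (f := fun t : ℂ => aeval (y + t • (x - y)) f)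
    (differentiable_aeval_line f y (x - y)).differentiableOn
    (fun t ht => Metric.ball_subset_closedBall <| by
      simp only [zero_smul, add_zero]
      refine hdist _ ?_ _ (hsub hy)
      rw [Metric.mem_ball, dist_eq_norm] at ht ⊢
      rw [sub_zero, lt_div_iff₀ hpos, dist_eq_norm, ← norm_smul] at ht
      rw [Metric.mem_closedBall, dist_eq_norm] at hy
      have := norm_add_le (y - M) (t • (x - y))
      have e : y + t • (x - y) - M = y - M + t • (x - y) := by abel
      rw [e]
      linarith)
    (by simpa [lt_div_iff₀ hpos] using hd)
  simp only [one_smul, zero_smul, add_zero, add_sub_cancel] at h1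
  refine h1.trans (le_of_eq ?_)
  simp
  field_simp

/-- Values and divided differences of all iterates are uniformly bounded near M, so the iterates are
equi-Lipschitz and Arzelà–Ascoli applies. -/
theorem mem_fatouSet_of_mem_interior {p : ℂ[X]} (hp : 2 ≤ p.natDegree)
    {M : Matrix (Fin 2) (Fin 2) ℂ} {a b : ℂ} (h : IsEigenPair M a b)
    (ha : a ∈ interior (filledJulia p)) (hb : b ∈ interior (filledJulia p)) :
    M ∈ fatouSet (matrixPoly p) := by
  obtain ⟨R, hR⟩ := exists_isEscapeRadius hp
  have hR1 := hR.1
  obtain ⟨δ₁, hδ₁, hsub₁⟩ := Metric.nhds_basis_closedBall.mem_iff.1 (mem_interior_iff_mem_nhds.1 ha)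
  obtain ⟨δ₂, hδ₂, hsub₂⟩ := Metric.nhds_basis_closedBall.mem_iff.1 (mem_interior_iff_mem_nhds.1 hb)
  -- The factor 2 leaves a disc of radius δ inside K_p around every eigenvalue perturbed by less
  -- than δ.
  obtain ⟨δ, hδ, h₁, h₂⟩ : ∃ δ : ℝ, 0 < δ ∧ 2 * δ ≤ δ₁ ∧ 2 * δ ≤ δ₂ :=
    ⟨min δ₁ δ₂ / 2, by positivity, by linarith [min_le_left δ₁ δ₂], by linarith [min_le_right δ₁ δ₂]⟩
  have hball : ∀ c, dist c a < δ ∨ dist c b < δ → Metric.closedBall c δ ⊆ filledJulia p := by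
    rintro c (hc | hc)
    · exact (Metric.closedBall_subset_closedBall' (by linarith)).trans hsub₁
    · exact (Metric.closedBall_subset_closedBall' (by linarith)).trans hsub₂
  obtain ⟨ρ, hρ, hnear⟩ := Metric.eventually_nhds_iff_ball.1 (h.eventually_near hδ)
  obtain ⟨r, hr, rfl⟩ : ∃ r, 0 < r ∧ ρ = 2 * r := ⟨ρ / 2, by positivity, by ring⟩
  set κ := ‖(1 : Matrix (Fin 2) (Fin 2) ℂ)‖
  have hbound : ∀ n, ∀ N ∈ Metric.ball M (2 * r), ‖aeval N (polyIter p n)‖ ≤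
      R * κ + 2 * R / δ * (‖M‖ + 2 * r + R * κ) := by
    intro n N hN
    obtain ⟨c, d, hcd⟩ := IsEigenPair.exists_isEigenPair N
    have hc := hball c ((hnear N hN) c d hcd).1
    have hd := hball d ((hnear N hN) d c hcd.symm).1
    have hcK : c ∈ filledJulia p := hc (Metric.mem_closedBall_self hδ.le)
    have hdK : d ∈ filledJulia p := hd (Metric.mem_closedBall_self hδ.le)
    have hcR : ‖c‖ ≤ R := by simpa using filledJulia_subset_closedBall hR hcK
    have hNM : ‖N‖ ≤ ‖M‖ + 2 * r := by
      rw [Metric.mem_ball, dist_eq_norm] at hN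
      linarith [norm_sub_norm_le N M]
    refine (hcd.norm_aeval_le _).trans ?_
    have h1 := (mem_filledJulia_iff hR).1 hcK n
    have h2 := norm_eval_divByMonic_le_of_ball (f := polyIter p n) hδ
      (fun z hz => (mem_filledJulia_iff hR).1 (hc hz) n) ((mem_filledJulia_iff hR).1 hdK n)
    gcongr
  refine ⟨Metric.ball M r, Metric.isOpen_ball, Metric.mem_ball_self hr,
    isNormalFamilyOn_of_strictMono fun s hs => ?_⟩
  have : ProperSpace (Matrix (Fin 2) (Fin 2) ℂ) := FiniteDimensional.proper ℂ _
  obtain ⟨φ, hφ, g, hg⟩ := exists_subseq_tendstoUniformlyOn (isCompact_closedBall M r)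
    (fun n N => (matrixPoly p)^[s n + 1] N) _ _
    (fun n x hx y hy => by
      rw [matrixPoly_iterate, matrixPoly_iterate]
      exact dist_aeval_le hr (hbound (s n + 1)) hx hy)
    (fun n x hx => by
      rw [matrixPoly_iterate]
      exact hbound _ x (Metric.closedBall_subset_ball (by linarith) hx))
  exact ⟨φ, hφ, Or.inl ⟨g, fun K hK _ => hg.mono (hK.trans Metric.ball_subset_closedBall)⟩⟩

/-- Adding t·1 shifts both eigenvalues by t, so escaping matrices occur arbitrarily close to M and
exclude convergence, while the bounded orbit of M excludes divergence. -/
theorem not_normal_of_bounded {p : ℂ[X]} (hp : 2 ≤ p.natDegree)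
    {M : Matrix (Fin 2) (Fin 2) ℂ} {a b : ℂ} (h : IsEigenPair M a b)
    (ha : a ∈ frontier (filledJulia p)) {B : ℝ} (hB : ∀ n, ‖(matrixPoly p)^[n] M‖ ≤ B) :
    M ∈ juliaSet (matrixPoly p) := by
  rintro ⟨U, hU, hMU, hN⟩
  have : ProperSpace (Matrix (Fin 2) (Fin 2) ℂ) := FiniteDimensional.proper ℂ _
  obtain ⟨t, htU, htK⟩ : ∃ t : ℂ, M + t • 1 ∈ U ∧ a + t ∉ filledJulia p := by
    have hc : Continuous fun z : ℂ => M + (z - a) • (1 : Matrix (Fin 2) (Fin 2) ℂ) := by fun_prop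
    have hmem : ∀ᶠ z in 𝓝 a, M + (z - a) • (1 : Matrix (Fin 2) (Fin 2) ℂ) ∈ U :=
      hc.continuousAt.eventually (by simpa using hU.mem_nhds hMU)
    rw [frontier_eq_closure_inter_closure] at ha
    obtain ⟨z, hz1, hz2⟩ := ((mem_closure_iff_frequently.1 ha.2).and_eventually hmem).exists
    exact ⟨z - a, hz2, by simpa using hz1⟩
  obtain ⟨φ, hφ, ⟨g, hg⟩ | hdiv⟩ := hN id
  · have h1 := (hg {M + t • 1} (Set.singleton_subset_iff.2 htU) isCompact_singleton).tendsto_at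
      (Set.mem_singleton _)
    have h2 := h1.norm.eventually_le_const (lt_add_one _)
    have ht : Tendsto (fun k => φ k + 1) atTop atTop :=
      (tendsto_add_atTop_nat 1).comp hφ.tendsto_atTop
    have h3 := ht.eventually (eventually_iter_gt_of_isCompact hp
      (isCompact_singleton (x := a + t)) (by simpa using htK)
      (2 * (‖g (M + t • 1)‖ + 1) + 2 * (‖g (M + t • 1)‖ + 1) ^ 2 + 1))
    obtain ⟨k, hk2, hk3⟩ := (h2.and h3).exists
    exact absurd (hk3 _ rfl)
      (not_lt.2 (((h.add_smul_one t).iterate (φ k + 1)).norm_le_of_norm_le hk2))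
  · obtain ⟨k, hk⟩ := (hdiv {M} (by simpa using hMU) isCompact_singleton
      (Metric.closedBall 0 B) (isCompact_closedBall _ _)).exists
    exact hk M (Set.mem_singleton M) (mem_closedBall_zero_iff.2 (hB (φ k + 1)))

theorem mem_juliaSet_of_ne {p : ℂ[X]} (hp : 2 ≤ p.natDegree)
    {M : Matrix (Fin 2) (Fin 2) ℂ} {a b : ℂ} (h : IsEigenPair M a b) (hab : a ≠ b)
    (ha : a ∈ frontier (filledJulia p)) (hb : b ∈ filledJulia p) :
    M ∈ juliaSet (matrixPoly p) := by
  obtain ⟨R, hR⟩ := exists_isEscapeRadius hp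
  have haK := (isClosed_filledJulia hp).frontier_subset ha
  refine not_normal_of_bounded hp h ha
    (B := R * ‖(1 : Matrix (Fin 2) (Fin 2) ℂ)‖ + 2 * R / ‖b - a‖ *
      (‖M‖ + ‖a‖ * ‖(1 : Matrix (Fin 2) (Fin 2) ℂ)‖)) fun n => ?_
  rw [matrixPoly_iterate]
  refine (h.norm_aeval_le _).trans ?_
  have h1 := (mem_filledJulia_iff hR).1 haK n
  have h2 := norm_eval_divByMonic_le (norm_pos_iff.2 (sub_ne_zero.2 hab.symm)) le_rfl h1
    ((mem_filledJulia_iff hR).1 hb n)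
  gcongr

theorem isClosed_juliaSet {E : Type*} [UniformSpace E] (f : E → E) : IsClosed (juliaSet f) := by
  rw [juliaSet, isClosed_compl_iff, isOpen_iff_forall_mem_open]
  rintro x ⟨U, hU, hx, hN⟩
  exact ⟨U, fun y hy => ⟨U, hU, hy, hN⟩, hU, hx⟩

/-- One eigenvalue of a nonscalar matrix with a double eigenvalue can be moved along a line. -/
theorem IsEigenPair.exists_perturbation {M : Matrix (Fin 2) (Fin 2) ℂ} {a : ℂ}
    (h : IsEigenPair M a a) (hM : M ≠ a • 1) :
    ∃ D : Matrix (Fin 2) (Fin 2) ℂ, ∀ t : ℂ, IsEigenPair (M + t • D) a (a + t) := by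
  obtain ⟨h1, h2⟩ := h
  rw [Matrix.trace_fin_two] at h1
  rw [Matrix.det_fin_two] at h2
  by_cases hb : M 0 1 = 0
  · by_cases hc : M 1 0 = 0
    · exfalso
      have h0 : (M 0 0 - a) ^ 2 = 0 := by
        have e : M 1 1 = 2 * a - M 0 0 := by linear_combination h1
        rw [hb, e] at h2
        linear_combination -h2
      have h00 : M 0 0 = a := by simpa [sub_eq_zero] using h0
      refine hM ?_
      ext i j
      fin_cases i <;> fin_cases j <;> simp [hb, hc, h00]
      linear_combination h1 - h00
    -- The direction has trace 1 and its off-diagonal entry is solved from det(M + tD) = a(a + t).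
    · refine ⟨!![1, (a - M 0 0) / M 1 0; 0, 0], fun t => ⟨?_, ?_⟩⟩
      · simp [Matrix.trace_fin_two]; linear_combination h1
      · simp [Matrix.det_fin_two]; field_simp; linear_combination h2 + t * h1
  · refine ⟨!![1, 0; (a - M 0 0) / M 0 1, 0], fun t => ⟨?_, ?_⟩⟩
    · simp [Matrix.trace_fin_two]; linear_combination h1
    · simp [Matrix.det_fin_two]; field_simp; linear_combination h2 + t * h1

theorem mem_juliaSet_of_mem_frontier {p : ℂ[X]} (hp : 2 ≤ p.natDegree)
    {M : Matrix (Fin 2) (Fin 2) ℂ} {a b : ℂ} (h : IsEigenPair M a b)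
    (ha : a ∈ frontier (filledJulia p)) (hb : b ∈ filledJulia p) :
    M ∈ juliaSet (matrixPoly p) := by
  rcases ne_or_eq a b with hab | rfl
  · exact mem_juliaSet_of_ne hp h hab ha hb
  by_cases hM : M = a • 1
  · obtain ⟨R, hR⟩ := exists_isEscapeRadius hp
    refine not_normal_of_bounded hp h ha
      (B := R * ‖(1 : Matrix (Fin 2) (Fin 2) ℂ)‖) fun n => ?_
    rw [matrixPoly_iterate, h.aeval_eq, hM, sub_self, smul_zero, add_zero, norm_smul]
    have := (mem_filledJulia_iff hR).1 hb n
    gcongr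
  -- Here the derivatives of the iterates enter, and the orbit need not be bounded. Instead M is a
  -- limit of matrices with distinct eigenvalues in K_p, as a is not isolated there, and the Julia
  -- set is closed.
  · obtain ⟨D, hD⟩ := h.exists_perturbation hM
    have hlim : Tendsto (fun t : ℂ => M + t • D) (𝓝 0) (𝓝 M) := by
      have : Continuous fun t : ℂ => M + t • D := by fun_prop
      simpa using this.tendsto 0
    refine (isClosed_juliaSet (matrixPoly p)).mem_of_frequently_of_tendsto ?_ hlim
    refine Metric.nhds_basis_ball.frequently_iff.2 fun {ε} hε => ?_
    obtain ⟨w, hw, hwa, hwε⟩ := exists_mem_filledJulia_near hp hb hε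
    refine ⟨w - a, by simpa [dist_eq_norm] using hwε, ?_⟩
    exact mem_juliaSet_of_ne hp (hD (w - a)) (by simpa using hwa.symm) ha (by simpa using hw)

/-- The Julia set of a matrix-valued polynomial in terms of eigenvalues. -/
theorem mem_juliaSet_iff {p : ℂ[X]} (hp : 2 ≤ p.natDegree)
    {M : Matrix (Fin 2) (Fin 2) ℂ} {a b : ℂ} (h : IsEigenPair M a b) :
    M ∈ juliaSet (matrixPoly p) ↔ a ∈ filledJulia p ∧ b ∈ filledJulia p ∧
      (a ∈ frontier (filledJulia p) ∨ b ∈ frontier (filledJulia p)) := by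
  constructor
  · intro hM
    have ha : a ∈ filledJulia p := by
      by_contra ha; exact hM (mem_fatouSet_of_notMem hp h ha)
    have hb : b ∈ filledJulia p := by
      by_contra hb; exact hM (mem_fatouSet_of_notMem hp h.symm hb)
    refine ⟨ha, hb, ?_⟩
    by_contra! hcon
    refine hM (mem_fatouSet_of_mem_interior hp h ?_ ?_)
    · by_contra hi; exact hcon.1 ⟨subset_closure ha, hi⟩
    · by_contra hi; exact hcon.2 ⟨subset_closure hb, hi⟩
  · rintro ⟨ha, hb, hf | hf⟩
    · exact mem_juliaSet_of_mem_frontier hp h hf hb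
    · exact mem_juliaSet_of_mem_frontier hp h.symm hf ha

/-! ### From matrix Julia sets to filled Julia sets and back -/

theorem juliaSet_eq_of_filledJulia_eq {p q : ℂ[X]} (hp : 2 ≤ p.natDegree) (hq : 2 ≤ q.natDegree)
    (h : filledJulia p = filledJulia q) : juliaSet (matrixPoly p) = juliaSet (matrixPoly q) := by
  ext M
  obtain ⟨a, b, hab⟩ := IsEigenPair.exists_isEigenPair M
  rw [mem_juliaSet_iff hp hab, mem_juliaSet_iff hq hab, h]

theorem smul_one_mem_juliaSet_iff {p : ℂ[X]} (hp : 2 ≤ p.natDegree) (c : ℂ) :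
    (c • 1 : Matrix (Fin 2) (Fin 2) ℂ) ∈ juliaSet (matrixPoly p) ↔
      c ∈ frontier (filledJulia p) := by
  rw [mem_juliaSet_iff hp (IsEigenPair.smul_one c)]
  have := fun hc => (isClosed_filledJulia hp).frontier_subset (a := c) hc
  tauto

theorem filledJulia_eq_of_juliaSet_eq {p q : ℂ[X]} (hp : 2 ≤ p.natDegree) (hq : 2 ≤ q.natDegree)
    (h : juliaSet (matrixPoly p) = juliaSet (matrixPoly q)) : filledJulia p = filledJulia q := by
  have hf : frontier (filledJulia p) = frontier (filledJulia q) := by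
    ext c
    rw [← smul_one_mem_juliaSet_iff hp, h, smul_one_mem_juliaSet_iff hq]
  exact (filledJulia_subset_of_frontier_eq hp hq hf).antisymm
    (filledJulia_subset_of_frontier_eq hq hp hf.symm)

theorem matrixPoly_smul_one (p : ℂ[X]) (c : ℂ) : matrixPoly p (c • 1) = p.eval c • 1 := by
  rw [matrixPoly_eq_aeval, (IsEigenPair.smul_one c).aeval_eq, sub_self, smul_zero, add_zero]

theorem eval_comm_of_matrixPoly_comm {p q : ℂ[X]}
    (h : matrixPoly p ∘ matrixPoly q = matrixPoly q ∘ matrixPoly p) (z : ℂ) :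
    p.eval (q.eval z) = q.eval (p.eval z) := by
  have := congrFun (congrFun (congrFun h (z • 1)) 0) 0
  simpa [matrixPoly_smul_one] using this

end MatrixDynamics

/-! ### Growth of polynomials at infinity -/

theorem tendsto_eval_div_pow {f : ℂ[X]} {m : ℕ} (hf : f.natDegree ≤ m) :
    Tendsto (fun z : ℂ => f.eval z / z ^ m) (Bornology.cobounded ℂ) (𝓝 (f.coeff m)) := by
  have h1 : ∀ i ∈ Finset.range (m + 1), Tendsto (fun z : ℂ => f.coeff i * (z ^ i / z ^ m))
      (Bornology.cobounded ℂ) (𝓝 (if i = m then f.coeff m else 0)) := by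
    intro i hi
    have hne : ∀ᶠ z in Bornology.cobounded ℂ, z ≠ 0 := Bornology.eventually_ne_cobounded 0
    split_ifs with him
    · subst him
      refine tendsto_const_nhds.congr' ?_
      filter_upwards [hne] with z hz
      field_simp
    · have hlt : i < m := lt_of_le_of_ne (Nat.lt_succ_iff.1 (Finset.mem_range.1 hi)) him
      have h2 := ((tendsto_inv₀_cobounded (α := ℂ)).pow (m - i)).const_mul (f.coeff i)
      rw [zero_pow (by omega), mul_zero] at h2
      refine h2.congr' ?_
      filter_upwards [hne] with z hz
      rw [inv_pow, ← pow_sub_mul_pow z hlt.le]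
      field_simp
  have h2 := tendsto_finsetSum _ h1
  simp only [Finset.sum_ite_eq', Finset.mem_range, Nat.lt_succ_self, if_true] at h2
  refine h2.congr fun z => ?_
  rw [eval_eq_sum_range' (Nat.lt_succ_of_le hf), Finset.sum_div]
  exact Finset.sum_congr rfl fun i _ => by ring

theorem exists_norm_eval_le {f g : ℂ[X]} (h : f.natDegree ≤ g.natDegree) (hg : g ≠ 0) :
    ∃ C R : ℝ, 0 ≤ C ∧ ∀ z : ℂ, R < ‖z‖ → ‖f.eval z‖ ≤ C * ‖g.eval z‖ := by
  have hl : g.leadingCoeff ≠ 0 := leadingCoeff_ne_zero.2 hg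
  have h1 := ((tendsto_eval_div_pow h).div (tendsto_eval_div_pow le_rfl) hl).norm
  have h2 := (h1.eventually_le_const (lt_add_one _)).and
    (((tendsto_eval_div_pow (f := g) le_rfl).eventually_ne hl))
  obtain ⟨R, hR⟩ := exists_norm_gt_of_eventually_cobounded h2
  refine ⟨‖f.coeff g.natDegree / g.coeff g.natDegree‖ + 1, R, by positivity, fun z hz => ?_⟩
  obtain ⟨h3, h4⟩ := hR z hz
  have hgz : g.eval z ≠ 0 := fun h0 => h4 (by simp [h0])
  have hzz : z ^ g.natDegree ≠ 0 := fun h0 => h4 (by simp [h0])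
  rw [Pi.div_apply, div_div_div_cancel_right₀ hzz, norm_div, div_le_iff₀ (norm_pos_iff.2 hgz)] at h3
  exact h3

/-- Completing the d-th power: c is the centroid of the roots, which removes the term of degree d -
1. This improves the later relative error from O(1/|z|) to O(1/|z|²). -/
theorem exists_natDegree_sub_le {p : ℂ[X]} (hp : 2 ≤ p.natDegree) :
    ∃ c : ℂ, (p - C c - C p.leadingCoeff * (X - C c) ^ p.natDegree).natDegree
      ≤ p.natDegree - 2 := by
  have hl : p.leadingCoeff ≠ 0 := leadingCoeff_ne_zero.2 (by rintro rfl; simp at hp)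
  refine ⟨-p.coeff (p.natDegree - 1) / (p.leadingCoeff * p.natDegree), ?_⟩
  rw [natDegree_le_iff_coeff_eq_zero]
  intro N hN
  obtain ⟨k, hk⟩ := Nat.exists_eq_add_of_le' hp
  have hkk : (p.natDegree : ℂ) = k + 2 := by rw [hk]; push_cast; ring
  have hk0 : (k : ℂ) + 2 ≠ 0 := by exact_mod_cast (by omega : k + 2 ≠ 0)
  rw [coeff_sub, coeff_sub, coeff_C_of_ne_zero (by omega), coeff_C_mul, sub_eq_add_neg X,
    ← C_neg, coeff_X_add_C_pow]
  rcases lt_trichotomy N p.natDegree with h | h | h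
  · have hN1 : N = k + 1 := by omega
    subst hN1
    rw [hkk, hk, leadingCoeff, hk] at *
    rw [show k + 2 - (k + 1) = 1 by omega, Nat.choose_succ_self_right,
      show k + 2 - 1 = k + 1 by omega]
    push_cast
    field_simp
    ring
  · subst h
    simp
  · rw [coeff_eq_zero_of_natDegree_lt h, Nat.choose_eq_zero_of_lt h]
    simp

theorem abs_log_norm_le {w : ℂ} (h : ‖w - 1‖ ≤ 1 / 2) : |Real.log ‖w‖| ≤ 2 * ‖w - 1‖ := by
  have h1 : |‖w‖ - 1| ≤ ‖w - 1‖ := by simpa using abs_norm_sub_norm_le w 1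
  obtain ⟨h2, h3⟩ := abs_le.1 h1
  have hw : 0 < ‖w‖ := by linarith
  rw [abs_le]
  constructor
  · have h4 := Real.one_sub_inv_le_log_of_pos hw
    have h5 : ‖w‖⁻¹ ≤ 1 + 2 * ‖w - 1‖ := by
      rw [inv_le_iff_one_le_mul₀ hw]
      nlinarith [norm_nonneg (w - 1)]
    linarith
  · have h4 := Real.log_le_sub_one_of_pos hw
    linarith [norm_nonneg (w - 1)]

/-- With respect to its centre, a polynomial agrees with its leading monomial to second order. -/
theorem exists_abs_log_sub_le {p : ℂ[X]} (hp : 2 ≤ p.natDegree) :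
    ∃ (c : ℂ) (B R : ℝ), 0 ≤ B ∧ ∀ z : ℂ, R < ‖z‖ →
      |Real.log ‖p.eval z - c‖ - p.natDegree * Real.log ‖z - c‖ - Real.log ‖p.leadingCoeff‖|
        ≤ B / ‖z‖ ^ 2 := by
  have hl : p.leadingCoeff ≠ 0 := leadingCoeff_ne_zero.2 (by rintro rfl; simp at hp)
  obtain ⟨c, hc⟩ := exists_natDegree_sub_le hp
  set r := p - C c - C p.leadingCoeff * (X - C c) ^ p.natDegree with hr
  set g := C p.leadingCoeff * (X - C c) ^ p.natDegree with hg
  have hgd : g.natDegree = p.natDegree := by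
    rw [hg, natDegree_C_mul hl, natDegree_pow, natDegree_X_sub_C, mul_one]
  have hg0 : g ≠ 0 := by rintro h0; rw [h0] at hgd; simp at hgd; omega
  obtain ⟨B, R, hB, hBR⟩ := exists_norm_eval_le (f := r * X ^ 2) (g := g) (by
    refine natDegree_mul_le.trans ?_
    rw [natDegree_X_pow, hgd]; omega) hg0
  refine ⟨c, 2 * B, max R (max ‖c‖ (2 * B + 1)), by positivity, fun z hz => ?_⟩
  simp only [max_lt_iff] at hz
  obtain ⟨hz1, hz2, hz3⟩ := hz
  have hzc : z - c ≠ 0 := fun h0 => by rw [sub_eq_zero] at h0; rw [h0] at hz2; exact hz2.false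
  have hgz : g.eval z = p.leadingCoeff * (z - c) ^ p.natDegree := by simp [hg]
  have hgz0 : g.eval z ≠ 0 := by rw [hgz]; exact mul_ne_zero hl (pow_ne_zero _ hzc)
  have hrz : p.eval z - c = g.eval z * (1 + r.eval z / g.eval z) := by
    rw [mul_add, mul_div_cancel₀ _ hgz0]; simp [hr, hg]
  have hzpos : 0 < ‖z‖ := by linarith
  have hsmall : ‖(1 + r.eval z / g.eval z) - 1‖ ≤ B / ‖z‖ ^ 2 := by
    have := hBR z hz1
    rw [eval_mul, norm_mul, eval_pow, eval_X, norm_pow] at this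
    rw [add_sub_cancel_left, norm_div, div_le_div_iff₀ (norm_pos_iff.2 hgz0) (by positivity)]
    exact this
  have hhalf : B / ‖z‖ ^ 2 ≤ 1 / 2 := by
    rw [div_le_div_iff₀ (by positivity) (by norm_num)]
    nlinarith
  have hw := abs_log_norm_le (hsmall.trans hhalf)
  have hw0 : (1 + r.eval z / g.eval z) ≠ 0 := by
    intro h0
    rw [h0] at hsmall
    simp at hsmall
    linarith
  have e : Real.log ‖p.eval z - c‖ = Real.log ‖p.leadingCoeff‖ + p.natDegree * Real.log ‖z - c‖
      + Real.log ‖1 + r.eval z / g.eval z‖ := by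
    rw [hrz, norm_mul, Real.log_mul (norm_ne_zero_iff.2 hgz0) (norm_ne_zero_iff.2 hw0), hgz,
      norm_mul, Real.log_mul (norm_ne_zero_iff.2 hl) (norm_ne_zero_iff.2 (pow_ne_zero _ hzc)),
      norm_pow, Real.log_pow]
  rw [e]
  calc _ = |Real.log ‖1 + r.eval z / g.eval z‖| := by congr 1; ring
    _ ≤ 2 * (B / ‖z‖ ^ 2) := hw.trans (by gcongr)
    _ = _ := by ring

/-! ### Green functions and their comparison -/

/-- `g` is the value at `z` of the Green function of the filled Julia set of `p`. -/
def HasGreen (p : ℂ[X]) (z : ℂ) (g : ℝ) : Prop :=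
  Tendsto (fun n => Real.log ‖(polyIter p n).eval z‖ / (p.natDegree : ℝ) ^ n) atTop (𝓝 g)

theorem HasGreen.eval {p : ℂ[X]} (hp : 2 ≤ p.natDegree) {z : ℂ} {g : ℝ} (h : HasGreen p z g) :
    HasGreen p (p.eval z) (p.natDegree * g) := by
  have hd : (p.natDegree : ℝ) ≠ 0 := by exact_mod_cast (by omega : p.natDegree ≠ 0)
  refine ((h.comp (tendsto_add_atTop_nat 1)).const_mul (p.natDegree : ℝ)).congr fun n => ?_
  simp only [Function.comp_apply, eval_polyIter_succ, pow_succ]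
  field_simp

/-- With L = log|a_d|/(d - 1), the function v(z) = log|z - c| + L satisfies v(p(z)) = d·v(z) +
O(|z|⁻²); telescoping v(pⁿ(z))/dⁿ gives the limit and its error. -/
theorem exists_hasGreen {p : ℂ[X]} (hp : 2 ≤ p.natDegree) :
    ∃ (c : ℂ) (L B R : ℝ), 0 ≤ B ∧ ∀ z : ℂ, R < ‖z‖ →
      ∃ g, HasGreen p z g ∧ |g - (Real.log ‖z - c‖ + L)| ≤ B / ‖z‖ ^ 2 := by
  obtain ⟨c, B, R₀, hB, hBR⟩ := exists_abs_log_sub_le hp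
  obtain ⟨R₁, hR₁⟩ := exists_isEscapeRadius hp
  have hesc : IsEscapeRadius p (max R₁ (max R₀ (2 * ‖c‖))) := hR₁.mono (le_max_left _ _)
  set R := max R₁ (max R₀ (2 * ‖c‖))
  have hRR : R₀ ≤ R := (le_max_left _ _).trans (le_max_right _ _)
  have hRc : 2 * ‖c‖ ≤ R := (le_max_right _ _).trans (le_max_right _ _)
  have hR1 := hesc.1
  have hd2 : (2 : ℝ) ≤ p.natDegree := by exact_mod_cast hp
  set d : ℝ := (p.natDegree : ℝ)
  have hd0 : 0 < d := by linarith
  set L := Real.log ‖p.leadingCoeff‖ / (d - 1) with hL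
  have hLe : Real.log ‖p.leadingCoeff‖ = d * L - L := by
    have : d - 1 ≠ 0 := by linarith
    rw [hL]; field_simp
  refine ⟨c, L, B, R, hB, fun z hz => ?_⟩
  set v : ℂ → ℝ := fun z => Real.log ‖z - c‖ + L with hv
  have hstep : ∀ w : ℂ, R < ‖w‖ → |v w - v (p.eval w) / d| ≤ B / ‖w‖ ^ 2 / d := by
    intro w hw
    have h1 := hBR w (hRR.trans_lt hw)
    rw [hLe] at h1
    have e : v w - v (p.eval w) / d =
        -((Real.log ‖p.eval w - c‖ - d * Real.log ‖w - c‖ - (d * L - L)) / d) := by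
      simp only [hv]; field_simp; ring
    rw [e, abs_neg, abs_div, abs_of_pos hd0]
    gcongr
  have hit : ∀ n, R < ‖(polyIter p n).eval z‖ := fun n => hz.trans_le (hesc.le_iter hz n)
  have hgeo : ∀ n, dist (v ((polyIter p n).eval z) / d ^ n)
      (v ((polyIter p (n + 1)).eval z) / d ^ (n + 1)) ≤ B / ‖z‖ ^ 2 / 2 * (1 / 2) ^ n := by
    intro n
    have e : v ((polyIter p n).eval z) / d ^ n - v ((polyIter p (n + 1)).eval z) / d ^ (n + 1) =
        (v ((polyIter p n).eval z) - v (p.eval ((polyIter p n).eval z)) / d) / d ^ n := by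
      rw [eval_polyIter_succ', pow_succ]; field_simp
    rw [Real.dist_eq, e, abs_div, abs_of_pos (pow_pos hd0 n), one_div, inv_pow, ← div_eq_mul_inv]
    have h1 := hesc.le_iter hz n
    have hzp : 0 < ‖z‖ := by linarith
    have h2 : B / ‖(polyIter p n).eval z‖ ^ 2 / d ≤ B / ‖z‖ ^ 2 / 2 := by gcongr
    exact div_le_div₀ (by positivity) ((hstep _ (hit n)).trans h2) (by positivity)
      (pow_le_pow_left₀ (by norm_num) hd2 n)
  obtain ⟨g, hg⟩ := cauchySeq_tendsto_of_complete
    (cauchySeq_of_le_geometric (1 / 2) (B / ‖z‖ ^ 2 / 2) (by norm_num) hgeo)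
  refine ⟨g, ?_, ?_⟩
  · have hbd : ∀ w : ℂ, R < ‖w‖ → |Real.log ‖w‖ - v w| ≤ Real.log 2 + |L| := by
      intro w hw
      have hw0 : 0 < ‖w‖ := by linarith
      have h1 := norm_sub_le w c
      have h2 := norm_sub_norm_le w c
      have hwc : 0 < ‖w - c‖ := by linarith
      have h3 : Real.log ‖w - c‖ ≤ Real.log 2 + Real.log ‖w‖ := by
        rw [← Real.log_mul (by norm_num) hw0.ne']
        exact Real.log_le_log hwc (by linarith)
      have h4 : Real.log ‖w‖ ≤ Real.log 2 + Real.log ‖w - c‖ := by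
        rw [← Real.log_mul (by norm_num) hwc.ne']
        exact Real.log_le_log hw0 (by linarith)
      have h5 := abs_le.1 (le_refl |L|)
      rw [abs_le]
      simp only [hv]
      constructor <;> linarith
    have h0 : Tendsto (fun n => (Real.log ‖(polyIter p n).eval z‖ - v ((polyIter p n).eval z))
        / d ^ n) atTop (𝓝 0) := by
      refine squeeze_zero_norm (a := fun n => (Real.log 2 + |L|) / d ^ n) (fun n => ?_) ?_
      · rw [Real.norm_eq_abs, abs_div, abs_of_pos (pow_pos hd0 n)]
        have := hbd _ (hit n)
        gcongr
      · exact (tendsto_const_nhds (x := Real.log 2 + |L|)).div_atTop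
          (tendsto_pow_atTop_atTop_of_one_lt (by linarith))
    have := hg.add h0
    rw [add_zero] at this
    exact this.congr fun n => by ring
  · have := dist_le_of_le_geometric_of_tendsto₀ (1 / 2) (B / ‖z‖ ^ 2 / 2) (by norm_num) hgeo hg
    rw [dist_comm, Real.dist_eq] at this
    simp only [pow_zero, div_one, eval_polyIter_zero] at this
    refine this.trans (le_of_eq ?_)
    ring

/-- A Bernstein–Walsh inequality on the exterior of a polynomial lemniscate. -/
theorem bernstein_walsh {f P : ℂ[X]} {m : ℕ} {M R : ℝ} (hf : f.natDegree ≤ m)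
    (hP : 0 < P.natDegree) (hR : 0 < R) (hM : 0 < M) (h : ∀ z, ‖P.eval z‖ ≤ R → ‖f.eval z‖ ≤ M)
    {z : ℂ} (hz : R < ‖P.eval z‖) :
    ‖f.eval z‖ ^ P.natDegree * R ^ (m + 1) ≤ M ^ P.natDegree * ‖P.eval z‖ ^ (m + 1) := by
  set D := P.natDegree with hD
  -- The exponent m + 1 instead of m makes F vanish at infinity, so the maximum principle works on a
  -- large bounded region; the loss disappears when m → ∞.
  set F : ℂ → ℂ := fun w => f.eval w ^ D / P.eval w ^ (m + 1) with hF
  have hl : P.leadingCoeff ≠ 0 := leadingCoeff_ne_zero.2 (by rintro rfl; simp [hD] at hP)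
  have hF0 : Tendsto F (Bornology.cobounded ℂ) (𝓝 0) := by
    have hlt : (f ^ D).natDegree < D * (m + 1) := by
      refine natDegree_pow_le.trans_lt ?_
      nlinarith
    have h1 := tendsto_eval_div_pow hlt.le
    have h2 := (tendsto_eval_div_pow (f := P) le_rfl).pow (m + 1)
    have h3 := h1.div h2 (pow_ne_zero _ hl)
    rw [coeff_eq_zero_of_natDegree_lt hlt, zero_div] at h3
    refine h3.congr' ?_
    filter_upwards [Bornology.eventually_ne_cobounded (0 : ℂ)] with w hw
    simp only [hF, Pi.div_apply, eval_pow]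
    rw [div_pow, ← pow_mul, div_div_div_cancel_right₀ (pow_ne_zero _ hw)]
  set B := M ^ D / R ^ (m + 1) with hB
  have hBpos : 0 < B := by positivity
  obtain ⟨ρ, hρ⟩ := exists_norm_gt_of_eventually_cobounded
    (hF0.norm.eventually_le_const (by simpa using hBpos))
  set U := {w : ℂ | R < ‖P.eval w‖} ∩ Metric.ball 0 (max ρ ‖z‖ + 1) with hU
  have hUo : IsOpen U := (isOpen_lt continuous_const (by fun_prop)).inter Metric.isOpen_ball
  have hcl : ∀ w ∈ closure U, R ≤ ‖P.eval w‖ := by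
    have : IsClosed {w : ℂ | R ≤ ‖P.eval w‖} := isClosed_le continuous_const (by fun_prop)
    have hsub : U ⊆ {w : ℂ | R ≤ ‖P.eval w‖} := fun w hw => le_of_lt (Set.mem_ofPred.1 hw.1)
    exact fun w hw => closure_minimal hsub this hw
  have hzU : z ∈ U := ⟨hz, by simp; linarith [le_max_right ρ ‖z‖]⟩
  have hbound : ‖F z‖ ≤ B := by
    refine Complex.norm_le_of_forall_mem_frontier_norm_le
      (Metric.isBounded_ball.subset Set.inter_subset_right)
      (DifferentiableOn.diffContOnCl fun w hw => ?_) (fun w hw => ?_) (subset_closure hzU)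
    · have hPw : P.eval w ≠ 0 := norm_pos_iff.1 (hR.trans_le (hcl w hw))
      exact ((f.differentiableAt.pow D).div (P.differentiableAt.pow (m + 1))
        (pow_ne_zero _ hPw)).differentiableWithinAt
    · rw [hUo.frontier_eq] at hw
      have hPw := hcl w hw.1
      by_cases hRw : R < ‖P.eval w‖
      · refine hρ w ?_
        have : w ∉ Metric.ball (0 : ℂ) (max ρ ‖z‖ + 1) := fun hb => hw.2 ⟨hRw, hb⟩
        simp at this
        linarith [le_max_left ρ ‖z‖]
      · simp only [hF, hB]
        rw [norm_div, norm_pow, norm_pow]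
        have := h w (not_lt.1 hRw)
        gcongr
  have hPz : 0 < ‖P.eval z‖ := hR.trans hz
  simp only [hF, hB] at hbound
  rwa [norm_div, norm_pow, norm_pow, div_le_div_iff₀ (by positivity) (by positivity)] at hbound

/-- Bernstein–Walsh for q^k on the lemniscates |pⁿ| ≤ R bounds log|q^k(z)| by log(R + 1) + (e^k +
1)g as n → ∞, where e = deg q; divide by e^k and let k → ∞. -/
theorem HasGreen.le_of_subset {p q : ℂ[X]} (hp : 2 ≤ p.natDegree) (hq : 2 ≤ q.natDegree)
    (hK : filledJulia p ⊆ filledJulia q) {R : ℝ} (hpR : IsEscapeRadius p R)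
    (hqR : IsEscapeRadius q R) {z : ℂ} (hz : R < ‖z‖) {g h : ℝ} (hg : HasGreen p z g)
    (hh : HasGreen q z h) : h ≤ g := by
  have hR1 := hpR.1
  have hd0 : (0 : ℝ) < p.natDegree := by exact_mod_cast (by omega : 0 < p.natDegree)
  have he1 : (1 : ℝ) < q.natDegree := by exact_mod_cast (by omega : 1 < q.natDegree)
  have key : ∀ k, Real.log ‖(polyIter q k).eval z‖ ≤
      Real.log (R + 1) + (q.natDegree ^ k + 1) * g := by
    intro k
    -- The points of the disc where q^k is large lie off K_q ⊇ K_p, so for large n they lie outside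
    -- the lemniscate |pⁿ| ≤ R.
    set L := Metric.closedBall (0 : ℂ) R ∩ {w | R + 1 ≤ ‖(polyIter q k).eval w‖} with hL
    have hLc : IsCompact L := (isCompact_closedBall _ _).inter_right
      (isClosed_le continuous_const (by fun_prop))
    obtain ⟨n₀, hn₀⟩ := exists_iter_gt_of_isCompact hpR hLc (Set.disjoint_left.2 fun w hw hwK => by
      have h1 := (mem_filledJulia_iff hqR).1 (hK hwK) k
      have h2 : R + 1 ≤ ‖(polyIter q k).eval w‖ := hw.2
      linarith)
    have hev : ∀ n ≥ n₀, Real.log ‖(polyIter q k).eval z‖ ≤ Real.log (R + 1) +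
        (q.natDegree ^ k + 1) * (Real.log ‖(polyIter p n).eval z‖ / (p.natDegree : ℝ) ^ n) := by
      intro n hn
      have hbw := bernstein_walsh (f := polyIter q k) (P := polyIter p n) (m := q.natDegree ^ k)
        (M := R + 1) (R := R) (natDegree_polyIter q k).le
        (by rw [natDegree_polyIter]; exact pow_pos (by omega) n) (by linarith) (by linarith)
        (fun w hw => by
          by_contra! hcon
          by_cases hwR : R < ‖w‖
          · linarith [hpR.le_iter hwR n]
          · exact absurd (hn₀ n hn w ⟨by simpa using hwR, hcon.le⟩) (not_lt.2 hw))
        (hz.trans_le (hpR.le_iter hz n))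
      rw [natDegree_polyIter] at hbw
      have hqz : 0 < ‖(polyIter q k).eval z‖ := by linarith [hqR.le_iter hz k]
      have hpz : 0 < ‖(polyIter p n).eval z‖ := by linarith [hpR.le_iter hz n]
      have h1 : ‖(polyIter q k).eval z‖ ^ (p.natDegree ^ n) ≤
          (R + 1) ^ (p.natDegree ^ n) * ‖(polyIter p n).eval z‖ ^ (q.natDegree ^ k + 1) :=
        (le_mul_of_one_le_right (by positivity) (one_le_pow₀ hR1)).trans hbw
      have h2 := Real.log_le_log (by positivity) h1
      rw [Real.log_mul (by positivity) (by positivity), Real.log_pow, Real.log_pow,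
        Real.log_pow] at h2
      push_cast at h2
      have hdn : (0 : ℝ) < (p.natDegree : ℝ) ^ n := by positivity
      refine le_of_mul_le_mul_left (h2.trans (le_of_eq ?_)) hdn
      field_simp
    refine ge_of_tendsto ((hg.const_mul _).const_add _) ?_
    filter_upwards [eventually_ge_atTop n₀] with n hn using hev n hn
  have hpow := tendsto_pow_atTop_atTop_of_one_lt he1
  have h1 : Tendsto (fun k : ℕ => (Real.log (R + 1) + g) / (q.natDegree : ℝ) ^ k + g) atTop
      (𝓝 (0 + g)) := (tendsto_const_nhds.div_atTop hpow).add_const g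
  rw [zero_add] at h1
  refine le_of_tendsto_of_tendsto' hh h1 fun k => ?_
  have hek : (0 : ℝ) < (q.natDegree : ℝ) ^ k := by positivity
  rw [div_le_iff₀ hek, add_mul, div_mul_cancel₀ _ hek.ne']
  linarith [key k]

theorem exists_common_green {p q : ℂ[X]} (hp : 2 ≤ p.natDegree) (hq : 2 ≤ q.natDegree)
    (hK : filledJulia p = filledJulia q) :
    ∃ (c : ℂ) (L B R : ℝ), 0 ≤ B ∧ IsEscapeRadius p R ∧ IsEscapeRadius q R ∧
      ∀ z : ℂ, R < ‖z‖ →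
        ∃ g, HasGreen p z g ∧ HasGreen q z g ∧ |g - (Real.log ‖z - c‖ + L)| ≤ B / ‖z‖ ^ 2 := by
  obtain ⟨c, L, B, R₁, hB, h₁⟩ := exists_hasGreen hp
  obtain ⟨_, _, _, R₂, _, h₂⟩ := exists_hasGreen hq
  obtain ⟨R₃, h₃⟩ := exists_isEscapeRadius hp
  obtain ⟨R₄, h₄⟩ := exists_isEscapeRadius hq
  set R := max (max R₁ R₂) (max R₃ R₄)
  have e₁ : R₁ ≤ R := (le_max_left _ _).trans (le_max_left _ _)
  have e₂ : R₂ ≤ R := (le_max_right _ _).trans (le_max_left _ _)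
  have h₃' : IsEscapeRadius p R := h₃.mono ((le_max_left _ _).trans (le_max_right _ _))
  have h₄' : IsEscapeRadius q R := h₄.mono ((le_max_right _ _).trans (le_max_right _ _))
  refine ⟨c, L, B, R, hB, h₃', h₄', fun z hz => ?_⟩
  obtain ⟨g, hg, hgb⟩ := h₁ z (e₁.trans_lt hz)
  obtain ⟨h, hh, -⟩ := h₂ z (e₂.trans_lt hz)
  have : h = g := (HasGreen.le_of_subset hp hq hK.subset h₃' h₄' hz hg hh).antisymm
    (HasGreen.le_of_subset hq hp hK.symm.subset h₄' h₃' hz hh hg)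
  exact ⟨g, hg, this ▸ hh, hgb⟩

/-! ### Rigidity of the two compositions -/

theorem exists_abs_log_comp_sub_le {p q : ℂ[X]} (hp : 2 ≤ p.natDegree) (hq : 2 ≤ q.natDegree)
    (hK : filledJulia p = filledJulia q) :
    ∃ (c : ℂ) (B R : ℝ), 0 ≤ B ∧ ∀ z : ℂ, R < ‖z‖ →
      |Real.log ‖p.eval (q.eval z) - c‖ - Real.log ‖q.eval (p.eval z) - c‖| ≤
        B / ‖p.eval (q.eval z)‖ ^ 2 + B / ‖q.eval (p.eval z)‖ ^ 2 := by
  obtain ⟨c, L, B, R, hB, hpR, hqR, H⟩ := exists_common_green hp hq hK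
  refine ⟨c, B, R, hB, fun z hz => ?_⟩
  have hz0 : 0 ≤ ‖z‖ := norm_nonneg z
  have hpz : R < ‖p.eval z‖ := by linarith [hpR.2 z hz]
  have hqz : R < ‖q.eval z‖ := by linarith [hqR.2 z hz]
  have hpq : R < ‖p.eval (q.eval z)‖ := by linarith [hpR.2 _ hqz, norm_nonneg (q.eval z)]
  have hqp : R < ‖q.eval (p.eval z)‖ := by linarith [hqR.2 _ hpz, norm_nonneg (p.eval z)]
  obtain ⟨g, hg₁, hg₂, -⟩ := H z hz
  obtain ⟨g₁, ha₁, ha₂, -⟩ := H _ hpz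
  obtain ⟨g₂, hb₁, hb₂, -⟩ := H _ hqz
  obtain ⟨g₃, hc₁, -, hc⟩ := H _ hpq
  obtain ⟨g₄, -, hd₂, hd⟩ := H _ hqp
  have e₁ : g₁ = p.natDegree * g := tendsto_nhds_unique ha₁ (hg₁.eval hp)
  have e₂ : g₂ = q.natDegree * g := tendsto_nhds_unique hb₂ (hg₂.eval hq)
  have e₃ : g₃ = p.natDegree * g₂ := tendsto_nhds_unique hc₁ (hb₁.eval hp)
  have e₄ : g₄ = q.natDegree * g₁ := tendsto_nhds_unique hd₂ (ha₂.eval hq)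
  have e : g₃ = g₄ := by rw [e₃, e₄, e₁, e₂]; ring
  rw [← e] at hd
  rw [abs_le] at *
  constructor <;> linarith [hc.1, hc.2, hd.1, hd.2]

/-- Leading coefficients have equal modulus, with quotient γ. If r = a - γb were nonzero, of degree
s < N, the cross term 2 Re(γ b r̄) would grow like t^(N+s) along a suitable ray, and |r|² ≥ 0 cannot
cancel it. -/
theorem eq_C_mul_of_norm_sq_sub_le {a b : ℂ[X]} (hab : a.natDegree = b.natDegree)
    (hb : 0 < b.natDegree) {B R : ℝ}
    (h : ∀ z : ℂ, R < ‖z‖ → |‖a.eval z‖ ^ 2 - ‖b.eval z‖ ^ 2| ≤ B) :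
    ∃ γ : ℂ, ‖γ‖ = 1 ∧ a = C γ * b := by
  have hb0 : b ≠ 0 := by rintro rfl; simp at hb
  have hβ : b.leadingCoeff ≠ 0 := leadingCoeff_ne_zero.2 hb0
  set N := b.natDegree with hN
  set α := a.coeff N with hα
  set β := b.coeff N with hβN
  have hβ0 : β ≠ 0 := hβ
  have ha' := tendsto_eval_div_pow hab.le
  have hb' := tendsto_eval_div_pow (f := b) hN.ge
  have hev : ∀ᶠ z in Bornology.cobounded ℂ, |‖a.eval z‖ ^ 2 - ‖b.eval z‖ ^ 2| ≤ B := by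
    filter_upwards [tendsto_norm_cobounded_atTop.eventually_gt_atTop R] with z hz using h z hz
  have hnorm : ‖α‖ = ‖β‖ := by
    have h1 := (ha'.norm.pow 2).sub (hb'.norm.pow 2)
    have h2 : Tendsto (fun z : ℂ => ‖a.eval z / z ^ N‖ ^ 2 - ‖b.eval z / z ^ N‖ ^ 2)
        (Bornology.cobounded ℂ) (𝓝 0) := by
      refine squeeze_zero_norm' (a := fun z : ℂ => B / ‖z‖ ^ (N * 2)) ?_ ?_
      · filter_upwards [hev] with z hz
        rw [norm_div, norm_div, norm_pow, div_pow, div_pow, ← sub_div, ← pow_mul,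
          Real.norm_eq_abs, abs_div, abs_of_nonneg (pow_nonneg (norm_nonneg z) _)]
        gcongr
      · exact tendsto_const_nhds.div_atTop
          ((tendsto_pow_atTop (by omega)).comp tendsto_norm_cobounded_atTop)
    have h3 := tendsto_nhds_unique h1 h2
    rw [sub_eq_zero] at h3
    exact (pow_left_inj₀ (norm_nonneg α) (norm_nonneg β) two_ne_zero).1 h3
  have hγ : ‖α / β‖ = 1 := by rw [norm_div, hnorm, div_self (norm_ne_zero_iff.2 hβ0)]
  refine ⟨α / β, hγ, ?_⟩
  set γ := α / β with hγd
  by_contra hne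
  set r := a - C γ * b with hr
  have hr0 : r ≠ 0 := sub_ne_zero.2 hne
  set s := r.natDegree with hs
  have hsN : s < N := by
    refine lt_of_le_of_ne ?_ fun hsN => ?_
    · exact (natDegree_sub_le _ _).trans (max_le hab.le (natDegree_C_mul_le _ _))
    · have h1 : r.coeff N ≠ 0 := by rw [← hsN]; exact leadingCoeff_ne_zero.2 hr0
      refine h1 ?_
      rw [hr, coeff_sub, coeff_C_mul]
      exact sub_eq_zero.2 (div_mul_cancel₀ α hβ0).symm
  set ρ := r.coeff s with hρ
  have hρ0 : ρ ≠ 0 := leadingCoeff_ne_zero.2 hr0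
  set κ := γ * β * (starRingEnd ℂ) ρ with hκ
  have hγ0 : γ ≠ 0 := norm_ne_zero_iff.1 (by rw [hγ]; exact one_ne_zero)
  have hκ0 : κ ≠ 0 := mul_ne_zero (mul_ne_zero hγ0 hβ0) (by simpa using hρ0)
  have hκn : 0 < ‖κ‖ := norm_pos_iff.2 hκ0
  -- The direction of the ray: it makes the leading coefficient of the cross term real and positive.
  obtain ⟨ω, hω⟩ := IsAlgClosed.exists_pow_nat_eq ((starRingEnd ℂ) κ / ‖κ‖)
    (show 0 < N - s by omega)
  have hω1 : ‖ω‖ = 1 := by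
    have := congrArg norm hω
    rw [norm_pow, norm_div, Complex.norm_conj, Complex.norm_real, norm_norm,
      div_self hκn.ne'] at this
    exact (pow_eq_one_iff_of_nonneg (norm_nonneg _) (by omega)).1 this
  have hωc : ω * (starRingEnd ℂ) ω = 1 := by
    rw [Complex.mul_conj, Complex.normSq_eq_norm_sq, hω1]; simp
  have hray : Tendsto (fun t : ℝ => (t : ℂ) * ω) atTop (Bornology.cobounded ℂ) := by
    rw [← tendsto_norm_atTop_iff_cobounded]
    simp only [norm_mul, hω1, mul_one, Complex.norm_real]
    exact tendsto_norm_atTop_atTop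
  have hr' := tendsto_eval_div_pow (f := r) hs.ge
  have hu := hb'.comp hray
  have hv := hr'.comp hray
  have hlim : Tendsto (fun t : ℝ => 2 * (γ * (b.eval (t * ω) / (t * ω) ^ N) *
      (starRingEnd ℂ) (r.eval (t * ω) / (t * ω) ^ s) * ω ^ (N - s)).re) atTop (𝓝 (2 * ‖κ‖)) := by
    have h1 := ((((hu.const_mul γ).mul ((Complex.continuous_conj.tendsto _).comp hv)).mul_const
      (ω ^ (N - s))))
    have h2 := ((Complex.continuous_re.tendsto _).comp h1).const_mul 2
    have e : (γ * β * (starRingEnd ℂ) ρ * ω ^ (N - s)).re = ‖κ‖ := by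
      rw [← hκ, hω, mul_div_assoc', Complex.mul_conj, Complex.normSq_eq_norm_sq]
      rw [← Complex.ofReal_div, Complex.ofReal_re]
      field_simp
    rw [e] at h2
    exact h2
  have htop := (tendsto_pow_atTop (α := ℝ) (show N + s ≠ 0 by omega)).atTop_mul_pos
    (by positivity) hlim
  obtain ⟨t, ⟨ht1, ht2⟩, ht3⟩ := ((htop.eventually_gt_atTop B).and
    (hray.eventually hev) |>.and (eventually_gt_atTop 0)).exists
  set z := (t : ℂ) * ω with hz
  have hω0 : ω ≠ 0 := norm_ne_zero_iff.1 (by rw [hω1]; exact one_ne_zero)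
  have hz0 : z ≠ 0 := mul_ne_zero (by exact_mod_cast ht3.ne') hω0
  have hzz : (((t ^ (N + s) : ℝ) : ℂ)) * ω ^ (N - s) = z ^ N * (starRingEnd ℂ) (z ^ s) := by
    have : ω ^ N = ω ^ (N - s) * ω ^ s := (pow_sub_mul_pow ω hsN.le).symm
    rw [hz, map_pow, map_mul, Complex.conj_ofReal, mul_pow, mul_pow, this, pow_add]
    push_cast
    have hωs : ω ^ s * (starRingEnd ℂ) ω ^ s = 1 := by rw [← mul_pow, hωc, one_pow]
    linear_combination (-(t : ℂ) ^ N * t ^ s * ω ^ (N - s)) * hωs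
  have hmain : t ^ (N + s) * (2 * (γ * (b.eval z / z ^ N) *
      (starRingEnd ℂ) (r.eval z / z ^ s) * ω ^ (N - s)).re) =
      2 * (γ * b.eval z * (starRingEnd ℂ) (r.eval z)).re := by
    have e : ((t ^ (N + s) : ℝ) : ℂ) * (γ * (b.eval z / z ^ N) *
        (starRingEnd ℂ) (r.eval z / z ^ s) * ω ^ (N - s)) =
        γ * b.eval z * (starRingEnd ℂ) (r.eval z) := by
      have hzs : (starRingEnd ℂ) (z ^ s) ≠ 0 := by simpa using fun h => absurd h hz0
      rw [map_div₀]
      calc _ = γ * (b.eval z / z ^ N) * ((starRingEnd ℂ) (r.eval z) / (starRingEnd ℂ) (z ^ s)) *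
            (((t ^ (N + s) : ℝ) : ℂ) * ω ^ (N - s)) := by ring
        _ = _ := by rw [hzz]; field_simp
    rw [← e, Complex.re_ofReal_mul]
    ring
  rw [hmain] at ht1
  have haz : a.eval z = γ * b.eval z + r.eval z := by simp [hr]
  have hexp : ‖a.eval z‖ ^ 2 = ‖b.eval z‖ ^ 2 +
      2 * (γ * b.eval z * (starRingEnd ℂ) (r.eval z)).re + ‖r.eval z‖ ^ 2 := by
    rw [haz, ← Complex.normSq_eq_norm_sq, Complex.normSq_add, Complex.normSq_mul,
      Complex.normSq_eq_norm_sq γ, hγ, Complex.normSq_eq_norm_sq, Complex.normSq_eq_norm_sq]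
    ring
  have := (abs_le.1 ht2).2
  nlinarith [sq_nonneg ‖r.eval z‖]

theorem exists_comp_eq_of_filledJulia_eq {p q : ℂ[X]} (hp : 2 ≤ p.natDegree)
    (hq : 2 ≤ q.natDegree) (hK : filledJulia p = filledJulia q) :
    ∃ γ b : ℂ, ‖γ‖ = 1 ∧ p.comp q = C γ * q.comp p + C b := by
  obtain ⟨c, B, R, hB, H⟩ := exists_abs_log_comp_sub_le hp hq hK
  set u := p.comp q - C c with hu
  set v := q.comp p - C c with hv
  have hud : u.natDegree = p.natDegree * q.natDegree := by
    rw [hu, natDegree_sub_C, natDegree_comp]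
  have hvd : v.natDegree = p.natDegree * q.natDegree := by
    rw [hv, natDegree_sub_C, natDegree_comp, mul_comm]
  have hN : 0 < p.natDegree * q.natDegree := by positivity
  have hcd₁ : (p.comp q).natDegree = p.natDegree * q.natDegree := natDegree_comp
  have hcd₂ : (q.comp p).natDegree = p.natDegree * q.natDegree := by rw [natDegree_comp, mul_comm]
  obtain ⟨C₁, R₁, hC₁, h₁⟩ := exists_norm_eval_le (f := v) (g := p.comp q) (by rw [hvd, hcd₁])
    (by rintro h0; rw [h0] at hcd₁; simp at hcd₁; omega)
  obtain ⟨C₂, R₂, hC₂, h₂⟩ := exists_norm_eval_le (f := v) (g := q.comp p) (by rw [hvd, hcd₂])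
    (by rintro h0; rw [h0] at hcd₂; simp at hcd₂; omega)
  set D := B * C₁ ^ 2 + B * C₂ ^ 2 with hD
  have hD0 : 0 ≤ D := by positivity
  have htv : Tendsto (fun z => ‖v.eval z‖) (Bornology.cobounded ℂ) atTop :=
    v.tendsto_norm_atTop (by rw [← natDegree_pos_iff_degree_pos]; omega)
      tendsto_norm_cobounded_atTop
  have htu : Tendsto (fun z => ‖u.eval z‖) (Bornology.cobounded ℂ) atTop :=
    u.tendsto_norm_atTop (by rw [← natDegree_pos_iff_degree_pos]; omega)
      tendsto_norm_cobounded_atTop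
  obtain ⟨R₃, h₃⟩ := exists_norm_gt_of_eventually_cobounded
    ((htv.eventually_gt_atTop (2 * D + 1)).and (htu.eventually_gt_atTop 0))
  obtain ⟨γ, hγ, huv⟩ := eq_C_mul_of_norm_sq_sub_le (a := u) (b := v) (hud.trans hvd.symm)
    -- |e^(2θ) - 1| ≤ 2|2θ| and |θ| ≤ D/|v|², so multiplying by |v|² leaves 4D.
    (by omega) (B := 4 * D) (R := max (max R R₁) (max R₂ R₃)) (fun z hz => by
      simp only [max_lt_iff] at hz
      obtain ⟨⟨hz, hz₁⟩, hz₂, hz₃⟩ := hz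
      obtain ⟨hv1, hu0⟩ := h₃ z hz₃
      have hv0 : 0 < ‖v.eval z‖ := by linarith
      have aux : ∀ (K y : ℝ), 0 ≤ K → ‖v.eval z‖ ≤ K * y →
          B / y ^ 2 ≤ B * K ^ 2 / ‖v.eval z‖ ^ 2 := by
        intro K y hK hy
        have hy0 : 0 < y := by
          by_contra! hy0
          nlinarith
        rw [div_le_div_iff₀ (by positivity) (by positivity)]
        calc B * ‖v.eval z‖ ^ 2 ≤ B * (K * y) ^ 2 := by gcongr
          _ = _ := by ring
      have hlog := H z hz
      have hx₁ := aux C₁ _ hC₁ (h₁ z hz₁)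
      have hx₂ := aux C₂ _ hC₂ (h₂ z hz₂)
      rw [eval_comp] at hx₁ hx₂
      have huz : u.eval z = p.eval (q.eval z) - c := by simp [hu]
      have hvz : v.eval z = q.eval (p.eval z) - c := by simp [hv]
      rw [← huz, ← hvz] at hlog
      set θ := Real.log ‖u.eval z‖ - Real.log ‖v.eval z‖ with hθ
      have hθb : |θ| ≤ D / ‖v.eval z‖ ^ 2 := by
        refine hlog.trans ((add_le_add hx₁ hx₂).trans (le_of_eq ?_))
        rw [hD]; ring
      have hθ1 : |2 * θ| ≤ 1 := by
        rw [abs_mul, abs_two]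
        have : D / ‖v.eval z‖ ^ 2 ≤ 1 / 2 := by
          rw [div_le_div_iff₀ (by positivity) (by norm_num)]
          nlinarith
        linarith
      have he : ‖u.eval z‖ ^ 2 = ‖v.eval z‖ ^ 2 * Real.exp (2 * θ) := by
        have : Real.exp θ = ‖u.eval z‖ / ‖v.eval z‖ := by
          rw [hθ, Real.exp_sub, Real.exp_log hu0, Real.exp_log hv0]
        rw [two_mul, Real.exp_add, this]
        field_simp
      have h5 := Real.abs_exp_sub_one_le hθ1
      rw [he, show ‖v.eval z‖ ^ 2 * Real.exp (2 * θ) - ‖v.eval z‖ ^ 2 =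
        ‖v.eval z‖ ^ 2 * (Real.exp (2 * θ) - 1) by ring, abs_mul, abs_of_nonneg (sq_nonneg _)]
      rw [abs_mul, abs_two] at h5
      rw [le_div_iff₀ (by positivity)] at hθb
      nlinarith [mul_le_mul_of_nonneg_left h5 (sq_nonneg ‖v.eval z‖)])
  refine ⟨γ, c - γ * c, hγ, ?_⟩
  have e : p.comp q = u + C c := by simp [hu]
  rw [e, huv, hv]
  simp only [C_sub, C_mul]
  ring

theorem mainTheorem7 (p q : ℂ[X]) (hp : 2 ≤ p.natDegree) (hq : 2 ≤ q.natDegree) :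
    (matrixPoly p ∘ matrixPoly q = matrixPoly q ∘ matrixPoly p →
      juliaSet (matrixPoly p) = juliaSet (matrixPoly q)) ∧
    (juliaSet (matrixPoly p) = juliaSet (matrixPoly q) →
      ∃ (a b : ℂ) (S : Matrix (Fin 2) (Fin 2) ℂ → Matrix (Fin 2) (Fin 2) ℂ),
        ‖a‖ = 1 ∧ (∀ M, S M = a • M + b • (1 : Matrix (Fin 2) (Fin 2) ℂ)) ∧
        matrixPoly p ∘ matrixPoly q = S ∘ matrixPoly q ∘ matrixPoly p) := by
  constructor
  · intro h
    have hc := eval_comm_of_matrixPoly_comm h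
    exact juliaSet_eq_of_filledJulia_eq hp hq ((filledJulia_subset_of_commute hp hc).antisymm
      (filledJulia_subset_of_commute hq fun z => (hc z).symm))
  · intro h
    obtain ⟨a, b, ha, hab⟩ :=
      exists_comp_eq_of_filledJulia_eq hp hq (filledJulia_eq_of_juliaSet_eq hp hq h)
    refine ⟨a, b, fun M => a • M + b • 1, ha, fun _ => rfl, funext fun M => ?_⟩
    have := congrArg (aeval M) hab
    simp only [Function.comp_apply, matrixPoly_eq_aeval]
    simpa [aeval_comp, Algebra.algebraMap_eq_smul_one] using this
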